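/- **Economies.** An economy $\Gamma=(I,O,\succ_I,\{C_o\}_{o\in O})$ consists of a finite set $I$ of agents, a finite set $O$ of objects, for each agent $i$ a strict linear order $\succ_i$ on $O\cup\{o^*\}$, where $o^*$ is a null object (write $x\succsim_i y$ if $x=y$ or $x\succ_i y$; objects may be worse than $o^*$), and for each $o\in O$ a nonempty set $C_o\subseteq I$ of owners. For $C\subseteq I$ let $\omega(C)=\{o\in O: C_o\subseteq C\}$. An allocation is a map $\mu:I\to O\cup\{o^*\}$ that assigns every $o\in O$ to at most one agent. A coalition is a nonempty set of agents. $\Gamma$ is a *house-allocation-with-existing-tenants (HET) economy* if there are a set $I'\subseteq I$ and pairwise distinct objects $h_i$ $(i\in I')$ with $C_{h_i}=\{i\}$, and $C_o=I$ for every other object $o$. **Exclusion core.** For an allocation $\mu$ and a coalition $C$ let $C^0=C$, $C^{k}=C^{k-1}\cup\mu^{-1}(\omega(C^{k-1}))$ and $\Omega(C|\omega,\mu)=\omega(\bigcup_{k\ge 0} C^k)$. The exclusion core is the set of allocations $\mu$ for which there are no coalition $C$ and allocation $\sigma$ such that $\sigma(i)\succ_i\mu(i)$ for all $i\in C$, and,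 for all $j\in I$, $\mu(j)\succ_j\sigma(j)$ implies $\mu(j)\in\Omega(C|\omega,\mu)$. **Rectified core and rectified core\*.** A set $C$ of agents is self-enforcing in $\sigma$ if $\sigma(C)\subseteq\omega(C)\cup\{o^*\}$. The rectified core is the set of allocations $\mu$ for which there are no coalition $C$ and allocation $\sigma$ such that (1) $\sigma(i)\succsim_i\mu(i)$ for all $i\in C$ and $\sigma(j)\succ_j\mu(j)$ for some $j\in C$; (2) $C$ is self-enforcing in $\sigma$; (3) for every coalition $C'\subseteq\{i\in C:\sigma(i)=\mu(i)\}$ that is self-enforcing in $\sigma$ and every $i\in C\setminus C'$, if $\sigma(i)\in\omega(C')$ then $\sigma(i)\notin\mu(I\setminus C)$. Let $\Gamma^*$ be an economy obtained from $\Gamma$ by adding an agent $i^*$ who ranks $o^*$ first (and the objects in any order after it) and who privately owns all objects $o$ that are publicly owned in $\Gamma$ (those with $C_o=I$); the preferences of the other agents and the owners of the other objects do not change. The *rectified core\** of $\Gamma$ is the set of restrictions to $I$ of the allocations in the rectified core of $\Gamma^*$. (Thus a blocking coalition can, with $i^*$, also use public objects, but cannot take those that are assigned to outsiders when $i^*$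 is unaffected.) **YRMH-IGYT.** Fix a linear order $\rhd$ of the agents; the current order is initially $\rhd$, and every object points to its $\rhd$-highest owner. Agents may obtain *shared ownership* of objects; initially there is none. In each step, first, every remaining object that points to an agent who has been removed is made to point to its $\rhd$-highest remaining owner, or, if there is none, to its $\rhd$-highest remaining shared owner, or, if there is none, to nobody; all other arcs between remaining agents and objects are maintained. Then the highest agent $i$ in the current order points to her favorite $x$ among the remaining objects and $o^*$. - If $x=o^*$ or $x$ points to nobody, $i$ obtains $x$, and $i$ (and $x$, if $x\neq o^*$) are removed. - If $x$ points to an agent and a cycle forms, every agent in the cycle obtains the object she points to, and the agents and objects of the cycle are removed. For every agent $j$ and object $b$ in the cycle, every remaining object $a$ of which $j$ was an owner or shared owner, and every remaining agent $j'$ who is an owner or shared owner of $b$, if $j'$ is not yet an owner or shared owner of $a$, then $j'$ becomes a shared owner of $a$. - If $x$ points to an agent and no cycle forms, that agent is moved to the top of the current order. The procedure ends when all agents have been removed. The outcomes of YRMH-IGYT are the allocations obtained in this way from all linear orders $\rhd$ of $I$. **Corollary.** In every HET economy, for every choice of the ranking of the objects by $i^*$ below $o^*$, the set of outcomes of YRMH-IGYT,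 the rectified core\*, and the exclusion core are equal. -/

import Mathlib

/-- An economy with complex endowments.  `I` is the set of agents and `O` the set of (real)
objects; `Option O` is `O ∪ {o*}`, with `none` the null object `o*`.  In `pref i` the larger of two
elements is the one that agent `i` prefers.  `owners o` is the nonempty set of owners of `o`. -/
structure Economy (I O : Type*) where
  pref : I → LinearOrder (Option O)
  owners : O → Set I
  owners_nonempty : ∀ o, (owners o).Nonempty

/-- An allocation: every agent gets one element of `O ∪ {o*}`, and no real object is assigned to two
agents. -/
def IsAllocation {I O : Type*} (μ : I → Option O) : Prop :=
  ∀ i j : I, ∀ o : O, μ i = some o → μ j = some o → i = j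

namespace Economy

variable {I O : Type*}

/-- Agent `i` strictly prefers `x` to `y`. -/
def Prefers (Γ : Economy I O) (i : I) (x y : Option O) : Prop := (Γ.pref i).lt y x

/-- Agent `i` weakly prefers `x` to `y`. -/
def WeaklyPrefers (Γ : Economy I O) (i : I) (x y : Option O) : Prop := x = y ∨ Γ.Prefers i x y

/-- The endowments of a set of agents: the objects all of whose owners belong to it. -/
def endowment (Γ : Economy I O) (C : Set I) : Set O := {o | Γ.owners o ⊆ C}

/-- House allocation with existing tenants: each agent of a set `T` (the existing tenants) privately
owns one object, distinct tenants own distinct objects, and every remaining object is owned by all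
agents. -/
def IsHET (Γ : Economy I O) : Prop :=
  ∃ (T : Set I) (house : T → O), Function.Injective house ∧
    (∀ i : T, Γ.owners (house i) = {(i : I)}) ∧
    ∀ o : O, o ∉ Set.range house → Γ.owners o = Set.univ

/-! ### The exclusion core -/

/-- `C ∪ μ⁻¹(ω(C))`. -/
def addOccupants (Γ : Economy I O) (μ : I → Option O) (C : Set I) : Set I :=
  C ∪ {i | ∃ o ∈ Γ.endowment C, μ i = some o}

/-- The set `Ω(C | ω, μ)` of the objects that `C` directly or indirectly controls at `μ`. -/
def controlled (Γ : Economy I O) (μ : I → Option O) (C : Set I) : Set O :=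
  Γ.endowment (⋃ k : ℕ, (Γ.addOccupants μ)^[k] C)

/-- `μ` is exclusion blocked by `C` via `σ`. -/
def ExclusionBlocked (Γ : Economy I O) (μ : I → Option O) (C : Set I) (σ : I → Option O) : Prop :=
  (∀ i ∈ C, Γ.Prefers i (σ i) (μ i)) ∧
    ∀ j : I, Γ.Prefers j (μ j) (σ j) → ∃ o ∈ Γ.controlled μ C, μ j = some o

/-- The exclusion core. -/
def exclusionCore (Γ : Economy I O) : Set (I → Option O) :=
  {μ | IsAllocation μ ∧ ¬ ∃ (C : Set I) (σ : I → Option O),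
    C.Nonempty ∧ IsAllocation σ ∧ Γ.ExclusionBlocked μ C σ}

/-! ### The rectified core -/

/-- `C` is self-enforcing in `σ`: `σ(C) ⊆ ω(C) ∪ {o*}`. -/
def SelfEnforcing (Γ : Economy I O) (σ : I → Option O) (C : Set I) : Prop :=
  ∀ i ∈ C, ∀ o : O, σ i = some o → o ∈ Γ.endowment C

/-- `μ` is rectification blocked by `C` via `σ`. -/
def RectificationBlocked (Γ : Economy I O) (μ : I → Option O) (C : Set I) (σ : I → Option O) :
    Prop :=
  ((∀ i ∈ C, Γ.WeaklyPrefers i (σ i) (μ i)) ∧ ∃ j ∈ C, Γ.Prefers j (σ j) (μ j)) ∧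
    Γ.SelfEnforcing σ C ∧
    ∀ D : Set I, D.Nonempty → D ⊆ {i ∈ C | σ i = μ i} → Γ.SelfEnforcing σ D →
      ∀ i ∈ C \ D, ∀ o ∈ Γ.endowment D, σ i = some o → ∀ j ∉ C, μ j ≠ some o

/-- The rectified core. -/
def rectifiedCore (Γ : Economy I O) : Set (I → Option O) :=
  {μ | IsAllocation μ ∧ ¬ ∃ (C : Set I) (σ : I → Option O),
    C.Nonempty ∧ IsAllocation σ ∧ Γ.RectificationBlocked μ C σ}

open Classical in
/-- The augmentation of an economy by one agent `i* = none` with preference `p`, who privately owns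
all the objects that are publicly owned in the given economy.  All other objects keep their
owners. -/
noncomputable def augment (Γ : Economy I O) (p : LinearOrder (Option O)) :
    Economy (Option I) O where
  pref := fun k => k.elim p Γ.pref
  owners := fun o => if Γ.owners o = Set.univ then {none} else some '' Γ.owners o
  owners_nonempty := fun o => by
    split_ifs
    · exact Set.singleton_nonempty none
    · exact (Γ.owners_nonempty o).image some

/-- The rectified core*: the restrictions to the original agents of the allocations in the rectified
core of the augmented economy, the additional agent `i*` having preference `p`. -/
def rectifiedCoreStar (Γ : Economy I O) (p : LinearOrder (Option O)) : Set (I → Option O) :=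
  {ν | ∃ μ ∈ (Γ.augment p).rectifiedCore, ν = fun i => μ (some i)}

/-! ### The "you request my house - I get your turn" mechanism -/

/-- A state of the mechanism.  `order` lists the remaining agents in their current order, highest
first; `objects` is the set of remaining objects; `shared o` contains the agents who have obtained
shared ownership of `o`; `agentArc` and `objectArc` are the arcs from agents to objects and from
objects to agents; `assigned` records the assignments of the removed agents. -/
structure YState (I O : Type*) where
  order : List I
  objects : Set O
  shared : O → Set I
  agentArc : I → Option O
  objectArc : O → Option I
  assigned : I → Option O

/-- The remaining owners of `o`. -/
def remOwners (Γ : Economy I O) (s : YState I O) (o : O) : Set I :=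
  {i | i ∈ s.order ∧ i ∈ Γ.owners o}

/-- The remaining agents with shared ownership of `o`. -/
def remSharers (s : YState I O) (o : O) : Set I := {i | i ∈ s.order ∧ i ∈ s.shared o}

/-- The remaining owners and shared owners of `o`. -/
def remHolders (Γ : Economy I O) (s : YState I O) (o : O) : Set I :=
  Γ.remOwners s o ∪ remSharers s o

open Classical in
/-- The highest agent of `S` in the order `r` (a list of the agents, highest first), if any. -/
noncomputable def highest (r : List I) (S : Set I) : Option I := r.find? (fun i => decide (i ∈ S))

open Classical in
/-- The agent to whom object `o` points during the step that starts in state `s`: an arc to a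
remaining agent is maintained; if the agent pointed to has been removed, `o` points to its highest
remaining owner, else to its highest remaining shared owner, else to nobody.  Here `r` is the
exogenous order. -/
noncomputable def pointer (Γ : Economy I O) (r : List I) (s : YState I O) (o : O) : Option I :=
  match s.objectArc o with
  | none => none
  | some j =>
    if j ∈ s.order then some j
    else (highest r (Γ.remOwners s o)).or (highest r (remSharers s o))

/-- `x` is the null object or a remaining object. -/
def Available (s : YState I O) (x : Option O) : Prop := ∀ o : O, x = some o → o ∈ s.objects

/-- `x` is agent `i`'s favorite among the remaining objects and the null object. -/
def IsFavorite (Γ : Economy I O) (s : YState I O) (i : I) (x : Option O) : Prop :=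
  Available s x ∧ ∀ y, Available s y → Γ.WeaklyPrefers i x y

/-- With the arcs `arc` of the agents, the remaining agent `j` points to a remaining object that
points to agent `k`. -/
def Link (Γ : Economy I O) (r : List I) (s : YState I O) (arc : I → Option O) (j k : I) : Prop :=
  j ∈ s.order ∧ ∃ o ∈ s.objects, arc j = some o ∧ Γ.pointer r s o = some k

/-- Agent `i` lies on a cycle. -/
def OnCycle (Γ : Economy I O) (r : List I) (s : YState I O) (arc : I → Option O) (i : I) : Prop :=
  Relation.TransGen (Γ.Link r s arc) i i

/-- The agents in the cycle through `i`. -/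
def cycleAgents (Γ : Economy I O) (r : List I) (s : YState I O) (arc : I → Option O) (i : I) :
    Set I :=
  {k | Relation.TransGen (Γ.Link r s arc) i k ∧ Relation.TransGen (Γ.Link r s arc) k i}

/-- The objects in the cycle through `i`. -/
def cycleObjects (Γ : Economy I O) (r : List I) (s : YState I O) (arc : I → Option O) (i : I) :
    Set O :=
  {o | ∃ k ∈ Γ.cycleAgents r s arc i, arc k = some o}

/-- Shared ownership after the removal of a cycle with agents `K` and objects `B`: for `j ∈ K`
holding `a` and `b ∈ B`, every remaining holder of `b` becomes a shared owner of `a` unless already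
holding it. -/
def newShared (Γ : Economy I O) (s : YState I O) (K : Set I) (B : Set O) (a : O) : Set I :=
  s.shared a ∪ {k | k ∉ K ∧ k ∉ Γ.remHolders s a ∧
    ∃ j ∈ K, j ∈ Γ.remHolders s a ∧ ∃ b ∈ B, k ∈ Γ.remHolders s b}

open Classical in
/-- One step of the mechanism with exogenous order `r`.  In each case `i` is the highest agent in
the current order, and points to her favorite `x` or `o`. -/
inductive YStep (Γ : Economy I O) (r : List I) : YState I O → YState I O → Prop
  /-- The favorite is the null object or points to nobody: `i` obtains it. -/
  | obtain (s : YState I O) (i : I) (rest : List I) (x : Option O)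
      (top : s.order = i :: rest) (fav : Γ.IsFavorite s i x)
      (unheld : ∀ o : O, x = some o → Γ.pointer r s o = none) :
      YStep Γ r s
        { order := rest
          objects := s.objects \ {o | x = some o}
          shared := s.shared
          agentArc := s.agentArc
          objectArc := Γ.pointer r s
          assigned := Function.update s.assigned i x }
  /-- A cycle forms: its agents obtain the objects they point to. -/
  | trade (s : YState I O) (i : I) (rest : List I) (o : O) (arc : I → Option O)
      (top : s.order = i :: rest) (fav : Γ.IsFavorite s i (some o))
      (arc_eq : arc = Function.update s.agentArc i (some o))
      (cycle : Γ.OnCycle r s arc i) :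
      YStep Γ r s
        { order := s.order.filter (fun k => decide (k ∉ Γ.cycleAgents r s arc i))
          objects := s.objects \ Γ.cycleObjects r s arc i
          shared := Γ.newShared s (Γ.cycleAgents r s arc i) (Γ.cycleObjects r s arc i)
          agentArc := arc
          objectArc := Γ.pointer r s
          assigned := fun k => if k ∈ Γ.cycleAgents r s arc i then arc k else s.assigned k }
  /-- The favorite points to agent `j` and no cycle forms: `j` is moved to the top. -/
  | request (s : YState I O) (i : I) (rest : List I) (o : O) (j : I) (arc : I → Option O)
      (top : s.order = i :: rest) (fav : Γ.IsFavorite s i (some o))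
      (held : Γ.pointer r s o = some j)
      (arc_eq : arc = Function.update s.agentArc i (some o))
      (no_cycle : ¬ Γ.OnCycle r s arc i) :
      YStep Γ r s
        { order := j :: s.order.filter (fun k => decide (k ≠ j))
          objects := s.objects
          shared := s.shared
          agentArc := arc
          objectArc := Γ.pointer r s
          assigned := s.assigned }

/-- The initial state: every object points to its highest owner. -/
noncomputable def yInit (Γ : Economy I O) (r : List I) : YState I O where
  order := r
  objects := Set.univ
  shared := fun _ => ∅
  agentArc := fun _ => none
  objectArc := fun o => highest r (Γ.owners o)
  assigned := fun _ => none

/-- The outcomes of the mechanism: the final assignments for all linear orders of the agents, a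
linear order being a list that contains every agent exactly once. -/
def yrmhOutcomes (Γ : Economy I O) : Set (I → Option O) :=
  {μ | ∃ r : List I, r.Nodup ∧ (∀ i, i ∈ r) ∧ ∃ s : YState I O,
    Relation.ReflTransGen (Γ.YStep r) (Γ.yInit r) s ∧ s.order = [] ∧ s.assigned = μ}

end Economy

/-! All three sets consist of the allocations that are ranked in the sense of `IsRanked`: the agents
fall into successive ranks, ties allowed, so that each gets a favorite among what the strictly
earlier ranks leave over, and no privately owned object goes to an agent ranked before its owner.
The proof goes round a circle: core allocation, schedule, outcome of the mechanism, ranked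
allocation, core allocation.

Ranked allocations lie in both cores (`IsRanked.mem_exclusionCore`,
`IsRanked.mem_rectifiedCoreStar`): consider the earliest change made by a block. In the exclusion
core, an earliest agent whose assignment changes is harmed, while a blocking coalition controls only
objects of later agents. In the rectified core, an earliest coalition member who gains takes the
object of an earlier outsider, whereas the still earlier members, together with `i*`, are unaffected
and own that object.

Conversely, let the agents of `S` have left, and let every other agent ask for her favorite
leftover: she asks its remaining private owner, failing that its occupant, failing that herself.
Some agents form a cycle. If any of them does not yet have what she asks for, the cycle blocks in
either sense (`TradingCycle.exclusionBlocked`, `TradingCycle.rectificationBlocked`). Hence at a core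
allocation the agents can leave one by one or in cycles of private objects, each with a favorite
leftover; this is a `Schedule`.

The schedule itself, taken as exogenous order, makes the mechanism produce the allocation
(`Schedule.mem_yrmhOutcomes`). Here shared ownership takes a simple form: the remaining holders of
an object are nobody, its private owner, or everybody (`PointerInvariant`). The same fact shows that
the removals in any run are successive ranks (`RunInvariant.step`), which closes the circle. -/

namespace Economy

variable {I O : Type*}

/-! ### Preferences -/

theorem Prefers.asymm {Γ : Economy I O} {i : I} {x y : Option O} (h : Γ.Prefers i x y) :
    ¬ Γ.Prefers i y x := by
  let := Γ.pref i
  exact lt_asymm (a := y) (b := x) h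

theorem Prefers.ne {Γ : Economy I O} {i : I} {x y : Option O} (h : Γ.Prefers i x y) : x ≠ y := by
  rintro rfl
  exact h.asymm h

theorem WeaklyPrefers.prefers_of_ne {Γ : Economy I O} {i : I} {x y : Option O}
    (h : Γ.WeaklyPrefers i x y) (hne : x ≠ y) : Γ.Prefers i x y :=
  h.resolve_left hne

theorem WeaklyPrefers.not_prefers {Γ : Economy I O} {i : I} {x y : Option O}
    (h : Γ.WeaklyPrefers i x y) : ¬ Γ.Prefers i y x := by
  rintro h'
  rcases h with rfl | h
  · exact h'.asymm h'
  · exact h.asymm h'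

theorem exists_weaklyPrefers_all [Finite O] (Γ : Economy I O) (i : I) {A : Set (Option O)}
    (hA : A.Nonempty) : ∃ x ∈ A, ∀ y ∈ A, Γ.WeaklyPrefers i x y := by
  let := Γ.pref i
  obtain ⟨x, hx, h⟩ := Set.exists_max_image A id A.toFinite hA
  refine ⟨x, hx, fun y hy => ?_⟩
  rcases (h y hy).eq_or_lt with h | h
  · exact Or.inl h.symm
  · exact Or.inr h

theorem exists_min_nat {α : Type*} (t : α → ℕ) (P : α → Prop) (h : ∃ a, P a) :
    ∃ a, P a ∧ ∀ b, P b → t a ≤ t b := by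
  classical
  have h' : ∃ n a, P a ∧ t a = n := let ⟨a, ha⟩ := h; ⟨_, a, ha, rfl⟩
  obtain ⟨a, ha, hn⟩ := Nat.find_spec h'
  exact ⟨a, ha, fun b hb => hn ▸ Nat.find_min' h' ⟨b, hb, rfl⟩⟩

/-! ### Economies with private and public ownership -/

/-- Every object is either public (`own o = none`) or has the single owner `m`, where
`own o = some m`. -/
structure OwnedBy (Γ : Economy I O) (own : O → Option I) : Prop where
  single : ∀ {o m}, own o = some m → Γ.owners o = {m}
  ne_univ : ∀ {o m}, own o = some m → Γ.owners o ≠ Set.univ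
  eq_univ : ∀ {o}, own o = none → Γ.owners o = Set.univ

theorem IsHET.exists_ownedBy {Γ : Economy I O} (h : Γ.IsHET) : ∃ own, Γ.OwnedBy own := by
  classical
  obtain ⟨T, house, -, hT, hpub⟩ := h
  have key : ∀ o, ∃ k : Option I, (∀ m, k = some m → Γ.owners o = {m} ∧ Γ.owners o ≠ Set.univ) ∧
      (k = none → Γ.owners o = Set.univ) := by
    intro o
    -- If there is only one agent, her house is owned by everybody. It must then count as public,
    -- because `augment` hands it to `i*`.
    by_cases hu : Γ.owners o = Set.univ
    · exact ⟨none, by simp, fun _ => hu⟩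
    · have ho : o ∈ Set.range house := by
        by_contra ho
        exact hu (hpub o ho)
      obtain ⟨i, rfl⟩ := ho
      refine ⟨some i, fun m hm => ?_, by simp⟩
      cases hm
      exact ⟨hT i, hu⟩
  choose own h1 h2 using key
  exact ⟨own, fun h => (h1 _ _ h).1, fun h => (h1 _ _ h).2, fun h => h2 _ h⟩

theorem OwnedBy.mem_endowment {Γ : Economy I O} {own : O → Option I} (h : Γ.OwnedBy own)
    {C : Set I} {o : O} :
    o ∈ Γ.endowment C ↔ (∃ m, own o = some m ∧ m ∈ C) ∨ own o = none ∧ C = Set.univ := by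
  unfold endowment
  rcases ho : own o with _ | m
  · simp [h.eq_univ ho]
  · simp [h.single ho]

/-- In the augmented economy every object has a single owner, and `own o`, read as an agent of
`Option I` with `none` as `i*`, is that owner. -/
theorem OwnedBy.mem_endowment_augment {Γ : Economy I O} {own : O → Option I} (h : Γ.OwnedBy own)
    (p : LinearOrder (Option O)) {C : Set (Option I)} {o : O} :
    o ∈ (Γ.augment p).endowment C ↔ own o ∈ C := by
  unfold endowment augment
  rcases ho : own o with _ | m
  · simp [h.eq_univ ho]
  · have := h.ne_univ ho
    rw [h.single ho] at this
    simp [h.single ho, this]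

/-! ### Ranked allocations -/

/-- The agents of `S` can be ranked in such a way that each of them gets at `μ` a favorite among all
objects not assigned to agents of lower rank, and nobody gets an object privately owned by an agent
of higher rank. -/
def IsRanked (Γ : Economy I O) (own : O → Option I) (μ : I → Option O) (S : Set I) : Prop :=
  ∃ t : I → ℕ, ∀ i ∈ S,
    (∀ y, (∀ j ∈ S, t j < t i → ∀ o, y = some o → μ j ≠ some o) → Γ.WeaklyPrefers i (μ i) y) ∧
    ∀ o m, μ i = some o → own o = some m → m ∈ S ∧ t m ≤ t i

theorem IsRanked.mem_exclusionCore {Γ : Economy I O} {own : O → Option I} (h : Γ.OwnedBy own)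
    {μ : I → Option O} (hμ : IsAllocation μ) (hr : Γ.IsRanked own μ Set.univ) :
    μ ∈ Γ.exclusionCore := by
  refine ⟨hμ, ?_⟩
  rintro ⟨C, σ, ⟨c, hc⟩, hσ, hC, hharm⟩
  obtain ⟨t, ht⟩ := hr
  obtain ⟨j, hj, hmin⟩ := exists_min_nat t (fun i => σ i ≠ μ i) ⟨c, (hC c hc).ne⟩
  -- Agents ranked before `j` keep their assignments, so whatever `i` receives was left over by
  -- them.
  have worse : ∀ i, σ i ≠ μ i → t i ≤ t j → Γ.Prefers i (μ i) (σ i) := by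
    intro i hi hij
    refine ((ht i trivial).1 (σ i) fun k _ hk o ho hko => ?_).prefers_of_ne (Ne.symm hi)
    have hσk : σ k = μ k := by
      by_contra hne
      exact absurd (hmin k hne) (by omega)
    have : k = i := hσ k i o (hσk.trans hko) ho
    subst this
    exact lt_irrefl _ hk
  have hCt : C ⊆ {k | t j < t k} := by
    intro i hi
    by_contra hlt
    exact (hC i hi).asymm (worse i (hC i hi).ne (not_lt.mp hlt))
  -- Control spreads from owners to occupants, who are ranked no earlier. Public objects never come
  -- under control, since `j` stays outside.
  have hiter : ∀ k, (Γ.addOccupants μ)^[k] C ⊆ {k | t j < t k} := by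
    intro k
    induction k with
    | zero => exact hCt
    | succ k ih =>
      rw [Function.iterate_succ_apply']
      rintro i (hi | ⟨o, ho, hio⟩)
      · exact ih hi
      · rcases h.mem_endowment.mp ho with ⟨m, hm, hmC⟩ | ⟨-, hu⟩
        · exact lt_of_lt_of_le (ih hmC) ((ht i trivial).2 o m hio hm).2
        · rw [hu] at ih
          exact (lt_irrefl (t j) (ih (Set.mem_univ j))).elim
  obtain ⟨o, ho, hjo⟩ := hharm j (worse j hj le_rfl)
  have hsub := Set.iUnion_subset hiter
  rcases h.mem_endowment.mp ho with ⟨m, hm, hmC⟩ | ⟨-, hu⟩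
  · exact absurd ((ht j trivial).2 o m hjo hm).2 (not_le.mpr (hsub hmC))
  · rw [hu] at hsub
    exact lt_irrefl (t j) (hsub (Set.mem_univ j))

theorem IsRanked.mem_rectifiedCoreStar {Γ : Economy I O} {own : O → Option I} (h : Γ.OwnedBy own)
    {p : LinearOrder (Option O)} (hp : ∀ o : O, p.lt (some o) none)
    {μ : I → Option O} (hμ : IsAllocation μ) (hr : Γ.IsRanked own μ Set.univ) :
    μ ∈ Γ.rectifiedCoreStar p := by
  refine ⟨fun k => k.elim none μ, ⟨?_, ?_⟩, rfl⟩
  · rintro (_ | i) (_ | j) o hi hj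
    · rfl
    · cases hi
    · cases hj
    · exact congrArg some (hμ i j o hi hj)
  rintro ⟨C, σ, -, hσ, ⟨hweak, c, hcC, hc⟩, hself, hrect⟩
  obtain ⟨t, ht⟩ := hr
  have hstar : none ∈ C → σ none = none := by
    intro hn
    rcases hσn : σ none with _ | o
    · rfl
    · have h1 := hweak none hn
      rw [hσn] at h1
      exact absurd (show (Γ.augment p).Prefers none none (some o) from hp o) h1.not_prefers
  have hc' : ∃ i, some i ∈ C ∧ σ (some i) ≠ μ i := by
    rcases c with _ | i
    · exact absurd (hstar hcC) hc.ne
    · exact ⟨i, hcC, hc.ne⟩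
  obtain ⟨i, ⟨hiC, hi⟩, hmin⟩ :=
    exists_min_nat t (fun i => some i ∈ C ∧ σ (some i) ≠ μ i) hc'
  have hbetter : Γ.Prefers i (σ (some i)) (μ i) :=
    (hweak (some i) hiC).prefers_of_ne hi
  -- An improvement on a favorite leftover must be an object of an earlier agent.
  obtain ⟨j, hji, o, hio, hjo⟩ : ∃ j, t j < t i ∧ ∃ o, σ (some i) = some o ∧ μ j = some o := by
    by_contra hcon
    push Not at hcon
    exact ((ht i trivial).1 (σ (some i)) fun j _ hj o ho => hcon j hj o ho).not_prefers hbetter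
  have heq : ∀ k, some k ∈ C → t k < t i → σ (some k) = μ k := by
    intro k hk hki
    by_contra hne
    exact absurd (hmin k ⟨hk, hne⟩) (by omega)
  have hjC : some j ∉ C := by
    intro hj
    have := hσ _ _ o ((heq j hj hji).trans hjo) hio
    cases this
    exact lt_irrefl _ hji
  have hown : ∀ k o, some k ∈ C → σ (some k) = some o → own o ∈ C := fun k o hk ho =>
    (h.mem_endowment_augment p).mp (hself _ hk o ho)
  -- The members ranked before `i`, and `i*` if she is a member, are unaffected and own what they
  -- hold. This is the coalition that violates the third condition of a block.
  set D : Set (Option I) := {k | k ∈ C ∧ ∀ m, k = some m → t m < t i} with hD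
  have hmemD : ∀ k o, some k ∈ C → own o ∈ C → μ k = some o → t k < t i → own o ∈ D := by
    intro k o hk hoC hko hki
    exact ⟨hoC, fun m hm => lt_of_le_of_lt ((ht k trivial).2 o m hko hm).2 hki⟩
  have hoD : own o ∈ D :=
    ⟨hown i o hiC hio, fun m hm => lt_of_le_of_lt ((ht j trivial).2 o m hjo hm).2 hji⟩
  refine hrect D ⟨_, hoD⟩ ?_ ?_ (some i) ⟨hiC, fun hiD => lt_irrefl _ (hiD.2 i rfl)⟩ o
    ((h.mem_endowment_augment p).mpr hoD) hio (some j) hjC hjo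
  · rintro (_ | k) hk
    · exact ⟨hk.1, hstar hk.1⟩
    · exact ⟨hk.1, heq k hk.1 (hk.2 k rfl)⟩
  · rintro (_ | k) hk o' ho'
    · rw [hstar hk.1] at ho'
      cases ho'
    · have hki := hk.2 k rfl
      exact (h.mem_endowment_augment p).mpr
        (hmemD k o' hk.1 (hown k o' hk.1 ho') ((heq k hk.1 hki).symm.trans ho') hki)

end Economy

namespace Economy

variable {I O : Type*}

/-! ### Trading cycles -/

/-- The null object and the objects that are not assigned to the agents of `S`. -/
def leftOver (μ : I → Option O) (S : Set I) : Set (Option O) :=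
  {y | ∀ j ∈ S, ∀ o, y = some o → μ j ≠ some o}

/-- `x` is agent `i`'s favorite in the set `A`. -/
def IsBest (Γ : Economy I O) (i : I) (A : Set (Option O)) (x : Option O) : Prop :=
  x ∈ A ∧ ∀ y ∈ A, Γ.WeaklyPrefers i x y

/-- The agent `k` whom one asks for `x` when the agents of `S` have left: the private owner of `x`
if she is not in `S`, otherwise the occupant of `x` at `μ`, otherwise agent `i` herself. -/
def Asks (own : O → Option I) (μ : I → Option O) (S : Set I) (i : I) (x : Option O) (k : I) :
    Prop :=
  (∃ o, x = some o ∧ own o = some k ∧ k ∉ S) ∨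
    (∀ o m, x = some o → own o = some m → m ∈ S) ∧
      ((∃ o, x = some o ∧ μ k = some o) ∨ (∀ j o, x = some o → μ j ≠ some o) ∧ k = i)

/-- The agents of `Z`, none of them in `S`, form a cycle in which everyone asks for her favorite
leftover. -/
structure TradingCycle (Γ : Economy I O) (own : O → Option I) (μ : I → Option O) (S Z : Set I)
    (x : I → Option O) (next : I → I) : Prop where
  nonempty : Z.Nonempty
  not_mem : ∀ i ∈ Z, i ∉ S
  best : ∀ i ∈ Z, Γ.IsBest i (leftOver μ S) (x i)
  asks : ∀ i ∈ Z, Asks own μ S i (x i) (next i)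
  next_mem : ∀ i ∈ Z, next i ∈ Z
  minimal : ∀ V ⊆ Z, V.Nonempty → (∀ i ∈ V, next i ∈ V) → V = Z

theorem mem_leftOver {μ : I → Option O} (hμ : IsAllocation μ) {S : Set I} {i : I} (hi : i ∉ S) :
    μ i ∈ leftOver μ S := by
  intro j hj o ho hjo
  exact hi (hμ i j o ho hjo ▸ hj)

/-- A minimal invariant set is a cycle of `f`. Minimality replaces walking round the cycle: a
property inherited along `f` that holds somewhere on it holds everywhere. -/
theorem exists_minimal_invariant {α : Type*} [Finite α] (f : α → α) {R : Set α} (hR : R.Nonempty)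
    (hf : ∀ i ∈ R, f i ∈ R) : ∃ Z ⊆ R, Z.Nonempty ∧ (∀ i ∈ Z, f i ∈ Z) ∧
      ∀ V ⊆ Z, V.Nonempty → (∀ i ∈ V, f i ∈ V) → V = Z := by
  obtain ⟨Z, ⟨hZR, hZ, hfZ⟩, hmin⟩ := exists_min_nat (fun Z : Set α => Z.ncard)
    (fun Z => Z ⊆ R ∧ Z.Nonempty ∧ ∀ i ∈ Z, f i ∈ Z) ⟨R, subset_rfl, hR, hf⟩
  refine ⟨Z, hZR, hZ, hfZ, fun V hVZ hV hfV => ?_⟩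
  exact Set.eq_of_subset_of_ncard_le hVZ (hmin V ⟨hVZ.trans hZR, hV, hfV⟩) Z.toFinite

theorem exists_tradingCycle [Finite I] [Finite O] (Γ : Economy I O) (own : O → Option I)
    (μ : I → Option O) {S : Set I} (hS : ∃ i, i ∉ S) :
    ∃ Z x next, Γ.TradingCycle own μ S Z x next := by
  classical
  have hx : ∀ i, ∃ x, Γ.IsBest i (leftOver μ S) x := fun i =>
    Γ.exists_weaklyPrefers_all i ⟨none, fun _ _ _ h => nomatch h⟩
  choose x hx using hx
  have hn : ∀ i, ∃ k, i ∉ S → k ∉ S ∧ Asks own μ S i (x i) k := by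
    intro i
    by_cases h1 : ∃ o k, x i = some o ∧ own o = some k ∧ k ∉ S
    · obtain ⟨o, k, ho, hk, hkS⟩ := h1
      exact ⟨k, fun _ => ⟨hkS, Or.inl ⟨o, ho, hk, hkS⟩⟩⟩
    · push Not at h1
      by_cases h2 : ∃ k o, x i = some o ∧ μ k = some o
      · obtain ⟨k, o, ho, hk⟩ := h2
        refine ⟨k, fun _ => ⟨fun hkS => (hx i).1 k hkS o ho hk, Or.inr ⟨h1, Or.inl ⟨o, ho, hk⟩⟩⟩⟩
      · push Not at h2
        exact ⟨i, fun hi => ⟨hi, Or.inr ⟨h1, Or.inr ⟨h2, rfl⟩⟩⟩⟩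
  choose next hn using hn
  obtain ⟨Z, hZ, hne, hnZ, hmin⟩ := exists_minimal_invariant next (R := Sᶜ) hS
    fun i hi => (hn i hi).1
  exact ⟨Z, x, next, hne, fun i hi => hZ hi, fun i _ => hx i, fun i hi => (hn i (hZ hi)).2, hnZ,
    hmin⟩

namespace TradingCycle

variable {Γ : Economy I O} {own : O → Option I} {μ : I → Option O} {S Z : Set I}
  {x : I → Option O} {next : I → I}

theorem eq_singleton (h : Γ.TradingCycle own μ S Z x next) {i : I} (hi : i ∈ Z)
    (hn : next i = i) : Z = {i} := by
  refine (h.minimal {i} (by simpa using hi) ⟨i, rfl⟩ ?_).symm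
  rintro _ rfl
  exact hn

/-- The image of `Z` under `next` is again invariant, hence all of `Z`, and a surjection of a finite
set onto itself is injective. -/
theorem next_injOn [Finite I] (h : Γ.TradingCycle own μ S Z x next) : Set.InjOn next Z := by
  have him : next '' Z = Z := by
    refine h.minimal _ ?_ (h.nonempty.image _) ?_
    · rintro _ ⟨i, hi, rfl⟩
      exact h.next_mem i hi
    · rintro _ ⟨i, hi, rfl⟩
      exact ⟨_, h.next_mem i hi, rfl⟩
  exact Set.injOn_of_ncard_image_eq (by rw [him]) Z.toFinite

/-- Two agents wanting the same object ask the same owner or the same occupant, so injectivity of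
`next` identifies them. If there is neither, each asks herself and the cycle is a singleton. -/
theorem injOn [Finite I] (h : Γ.TradingCycle own μ S Z x next) (hμ : IsAllocation μ) {i k : I}
    (hi : i ∈ Z) (hk : k ∈ Z) {o : O} (hio : x i = some o) (hko : x k = some o) : i = k := by
  have hself : ∀ i ∈ Z, ∀ k ∈ Z, next i = i → i = k := by
    intro i hi k hk hn
    rw [h.eq_singleton hi hn] at hk
    exact hk.symm
  rcases h.asks i hi with ⟨o1, h1, h2, h3⟩ | ⟨h1, ⟨o1, h2, h3⟩ | ⟨h2, h3⟩⟩
  · cases hio.symm.trans h1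
    rcases h.asks k hk with ⟨o2, h4, h5, h6⟩ | ⟨h4, -⟩
    · cases hko.symm.trans h4
      exact h.next_injOn hi hk (Option.some.inj (h2.symm.trans h5))
    · exact absurd (h4 o _ hko h2) h3
  · cases hio.symm.trans h2
    rcases h.asks k hk with ⟨o2, h4, h5, h6⟩ | ⟨h4, ⟨o2, h5, h6⟩ | ⟨h5, h6⟩⟩
    · cases hko.symm.trans h4
      exact absurd (h1 o _ hio h5) h6
    · cases hko.symm.trans h5
      exact h.next_injOn hi hk (hμ _ _ o h3 h6)
    · exact (hself k hk i hi h6).symm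
  · exact hself i hi k hk h3

/-- An agent of a trading cycle who already has her favorite leftover asks its private owner or
herself. -/
theorem asks_of_eq (h : Γ.TradingCycle own μ S Z x next) (hμ : IsAllocation μ) {i : I} (hi : i ∈ Z)
    (hx : x i = μ i) : (∃ o, μ i = some o ∧ own o = some (next i) ∧ next i ∉ S) ∨
      (∀ o m, μ i = some o → own o = some m → m ∈ S) ∧ next i = i := by
  have := h.asks i hi
  rw [hx] at this
  rcases this with h1 | ⟨h1, ⟨o, h2, h3⟩ | ⟨-, h2⟩⟩
  · exact Or.inl h1
  · exact Or.inr ⟨h1, hμ _ _ o h3 h2⟩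
  · exact Or.inr ⟨h1, h2⟩

/-- The agents of the cycle who would gain form the coalition; outsiders holding a requested object
are evicted to the null object. Such an object was requested from its private owner, because asking
the occupant would put her in the cycle, so it remains to see that the coalition comes to control
the whole cycle. -/
theorem exclusionBlocked [Finite I] (h : Γ.TradingCycle own μ S Z x next) (hown : Γ.OwnedBy own)
    (hμ : IsAllocation μ) (hne : ∃ i ∈ Z, x i ≠ μ i) : μ ∉ Γ.exclusionCore := by
  classical
  rintro ⟨-, hcore⟩
  apply hcore
  set C : Set I := {i | i ∈ Z ∧ x i ≠ μ i} with hC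
  set σ : I → Option O := fun k => if k ∈ Z then x k else
    if ∃ i ∈ Z, ∃ o, x i = some o ∧ μ k = some o then none else μ k with hσ
  have hσZ : ∀ k ∈ Z, σ k = x k := fun k hk => if_pos hk
  have hσμ : ∀ k ∉ Z, ∀ o, σ k = some o → μ k = some o ∧ ∀ i ∈ Z, x i ≠ some o := by
    intro k hk o ho
    simp only [hσ, if_neg hk] at ho
    split_ifs at ho with hcon
    exact ⟨ho, fun i hi hio => hcon ⟨i, hi, o, hio, ho⟩⟩
  have hbest : ∀ i ∈ Z, Γ.WeaklyPrefers i (x i) (μ i) := fun i hi =>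
    (h.best i hi).2 _ (mem_leftOver hμ (h.not_mem i hi))
  set cl : Set I := ⋃ k : ℕ, (Γ.addOccupants μ)^[k] C with hcl
  have hCcl : C ⊆ cl := Set.subset_iUnion (fun k : ℕ => (Γ.addOccupants μ)^[k] C) 0
  have hclosed : ∀ o m k, own o = some m → m ∈ cl → μ k = some o → k ∈ cl := by
    intro o m k hm hmcl hk
    obtain ⟨n, hn⟩ := Set.mem_iUnion.mp hmcl
    refine Set.mem_iUnion.mpr ⟨n + 1, ?_⟩
    rw [Function.iterate_succ_apply']
    exact Or.inr ⟨o, hown.mem_endowment.mpr (Or.inl ⟨m, hm, hn⟩), hk⟩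
  -- An agent of the cycle outside `cl` keeps her assignment, so she asks its owner or herself. If
  -- the owner were in `cl`, the occupant would be too; hence the agents outside `cl` form an
  -- invariant set, which misses the coalition.
  have hZcl : ∀ m ∈ Z, m ∈ cl := by
    by_contra hcon
    push Not at hcon
    have hV := h.minimal {m | m ∈ Z ∧ m ∉ cl} (fun m hm => hm.1) hcon ?_
    · obtain ⟨i, hi, hxi⟩ := hne
      have hi' := hi
      rw [← hV] at hi'
      exact hi'.2 (hCcl ⟨hi, hxi⟩)
    · rintro m ⟨hmZ, hmcl⟩
      have hxm : x m = μ m := by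
        by_contra hxm
        exact hmcl (hCcl ⟨hmZ, hxm⟩)
      refine ⟨h.next_mem m hmZ, fun hncl => ?_⟩
      rcases h.asks_of_eq hμ hmZ hxm with ⟨o, h1, h2, -⟩ | ⟨-, h1⟩
      · exact hmcl (hclosed o _ m h2 hncl h1)
      · rw [h1] at hncl
        exact hmcl hncl
  refine ⟨C, σ, hne, ?_, ?_, ?_⟩
  · intro i j o hi hj
    by_cases hiZ : i ∈ Z <;> by_cases hjZ : j ∈ Z
    · rw [hσZ _ hiZ] at hi
      rw [hσZ _ hjZ] at hj
      exact h.injOn hμ hiZ hjZ hi hj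
    · rw [hσZ _ hiZ] at hi
      exact absurd hi ((hσμ j hjZ o hj).2 i hiZ)
    · rw [hσZ _ hjZ] at hj
      exact absurd hj ((hσμ i hiZ o hi).2 j hjZ)
    · exact hμ i j o (hσμ i hiZ o hi).1 (hσμ j hjZ o hj).1
  · rintro i ⟨hi, hxi⟩
    rw [hσZ i hi]
    exact (hbest i hi).prefers_of_ne hxi
  · intro j hj
    by_cases hjZ : j ∈ Z
    · rw [hσZ j hjZ] at hj
      exact absurd hj (hbest j hjZ).not_prefers
    · by_cases hcon : ∃ i ∈ Z, ∃ o, x i = some o ∧ μ j = some o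
      · obtain ⟨i, hi, o, hio, hjo⟩ := hcon
        refine ⟨o, ?_, hjo⟩
        rcases h.asks i hi with ⟨o1, h1, h2, -⟩ | ⟨-, ⟨o1, h1, h2⟩ | ⟨h1, -⟩⟩
        · cases hio.symm.trans h1
          exact hown.mem_endowment.mpr (Or.inl ⟨_, h2, hZcl _ (h.next_mem i hi)⟩)
        · cases hio.symm.trans h1
          exact absurd (hμ _ _ o hjo h2 ▸ h.next_mem i hi) hjZ
        · exact absurd hjo (h1 j o hio)
      · have : σ j = μ j := by simp only [hσ, if_neg hjZ, if_neg hcon]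
        exact absurd this.symm hj.ne

/-- The coalition is the cycle together with `S` and `i*`. It owns all it uses: a remaining private
owner of a requested object is asked and so lies in the cycle, other private owners lie in `S`, and
`i*` owns the public objects. -/
theorem rectificationBlocked [Finite I] (h : Γ.TradingCycle own μ S Z x next)
    (hown : Γ.OwnedBy own) (p : LinearOrder (Option O)) (hμ : IsAllocation μ)
    (hS : ∀ i ∈ S, ∀ o m, μ i = some o → own o = some m → m ∈ S) (hne : ∃ i ∈ Z, x i ≠ μ i)
    {ν : Option I → Option O} (hν : ∀ i, ν (some i) = μ i) (hν' : ν none = none) :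
    ν ∉ (Γ.augment p).rectifiedCore := by
  classical
  rintro ⟨-, hcore⟩
  apply hcore
  -- Agents outside the coalition get the null object, which avoids conflicts and does not matter
  -- for the block.
  set τ : I → Option O := fun k => if k ∈ Z then x k else if k ∈ S then μ k else none with hτ
  have hτZ : ∀ k ∈ Z, τ k = x k := fun k hk => if_pos hk
  have hτS : ∀ k ∈ S, τ k = μ k := fun k hk => by
    simp only [hτ, if_pos hk, if_neg fun hkZ => h.not_mem k hkZ hk]
  have hτc : ∀ k o, τ k = some o → k ∈ Z ∨ k ∈ S := by
    intro k o hk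
    simp only [hτ] at hk
    split_ifs at hk with h1 h2
    · exact Or.inl h1
    · exact Or.inr h2
  have hbest : ∀ i ∈ Z, Γ.WeaklyPrefers i (x i) (μ i) := fun i hi =>
    (h.best i hi).2 _ (mem_leftOver hμ (h.not_mem i hi))
  set C : Set (Option I) := {k | ∀ i, k = some i → i ∈ Z ∨ i ∈ S} with hC
  have hmemC : ∀ i, some i ∈ C ↔ i ∈ Z ∨ i ∈ S := fun i =>
    ⟨fun hi => hi i rfl, fun hi j hj => by cases hj; exact hi⟩
  have hnoneC : none ∈ C := fun _ hi => nomatch hi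
  refine ⟨C, fun k => k.elim none τ, ⟨none, hnoneC⟩, ?_, ⟨?_, ?_⟩, ?_, ?_⟩
  · rintro (_ | i) (_ | j) o hi hj
    · rfl
    · cases hi
    · cases hj
    · refine congrArg some ?_
      change τ i = some o at hi
      change τ j = some o at hj
      rcases hτc i o hi with hi' | hi' <;> rcases hτc j o hj with hj' | hj'
      · rw [hτZ _ hi'] at hi
        rw [hτZ _ hj'] at hj
        exact h.injOn hμ hi' hj' hi hj
      · rw [hτZ _ hi'] at hi
        rw [hτS _ hj'] at hj
        exact absurd hj ((h.best i hi').1 j hj' o hi)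
      · rw [hτS _ hi'] at hi
        rw [hτZ _ hj'] at hj
        exact absurd hi ((h.best j hj').1 i hi' o hj)
      · rw [hτS _ hi'] at hi
        rw [hτS _ hj'] at hj
        exact hμ i j o hi hj
  · rintro (_ | i) hi
    · exact Or.inl hν'.symm
    · rw [hν]
      change Γ.WeaklyPrefers i (τ i) (μ i)
      rcases (hmemC i).mp hi with hi | hi
      · rw [hτZ i hi]
        exact hbest i hi
      · exact Or.inl (hτS i hi)
  · obtain ⟨i, hi, hxi⟩ := hne
    refine ⟨some i, (hmemC i).mpr (Or.inl hi), ?_⟩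
    rw [hν]
    change Γ.Prefers i (τ i) (μ i)
    rw [hτZ i hi]
    exact (hbest i hi).prefers_of_ne hxi
  · rintro (_ | i) hi o ho
    · cases ho
    change τ i = some o at ho
    rw [hown.mem_endowment_augment]
    intro m hm
    rcases (hmemC i).mp hi with hi | hi
    · rw [hτZ i hi] at ho
      rcases h.asks i hi with ⟨o1, h1, h2, -⟩ | ⟨h1, -⟩
      · cases ho.symm.trans h1
        cases hm.symm.trans h2
        exact Or.inl (h.next_mem i hi)
      · exact Or.inr (h1 o m ho hm)
    · rw [hτS i hi] at ho
      exact Or.inr (hS i hi o m ho hm)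
  · rintro D - hDC hDself (_ | i) ⟨hiC, hiD⟩ o hoD hio (_ | j) hjC hjo
    · cases hio
    · cases hio
    · exact hjC hnoneC
    change τ i = some o at hio
    rw [hν] at hjo
    rw [hown.mem_endowment_augment] at hoD
    have hjC' : j ∉ Z ∧ j ∉ S := by simpa [hmemC] using hjC
    rcases (hmemC i).mp hiC with hi | hi
    · rw [hτZ i hi] at hio
      rcases h.asks i hi with ⟨o1, h1, h2, -⟩ | ⟨-, ⟨o1, h1, h2⟩ | ⟨h1, -⟩⟩
      · cases hio.symm.trans h1
        rw [h2] at hoD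
        -- Unaffected agents of the cycle ask the owners of what they hold or themselves, and `D` is
        -- self-enforcing. So `D` contains the whole cycle once it contains the owner asked by `i`,
        -- and then contains `i`.
        have hV := h.minimal {m | m ∈ Z ∧ some m ∈ D} (fun m hm => hm.1)
          ⟨_, h.next_mem i hi, hoD⟩ ?_
        · rw [← hV] at hi
          exact hiD hi.2
        · rintro m ⟨hm, hmD⟩
          refine ⟨h.next_mem m hm, ?_⟩
          have hτm : τ m = μ m := (hDC hmD).2.trans (hν m)
          have hxm : x m = μ m := (hτZ m hm).symm.trans hτm
          rcases h.asks_of_eq hμ hm hxm with ⟨o2, h3, h4, -⟩ | ⟨-, h3⟩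
          · have := (hown.mem_endowment_augment p).mp (hDself _ hmD o2 (hτm.trans h3))
            rwa [h4] at this
          · rwa [h3]
      · cases hio.symm.trans h1
        exact hjC'.1 (hμ _ _ o hjo h2 ▸ h.next_mem i hi)
      · exact h1 j o hio hjo
    · rw [hτS i hi] at hio
      exact hjC'.2 (hμ _ _ o hjo hio ▸ hi)

end TradingCycle

/-! ### Schedules -/

/-- The agents of the list can leave with their assignments at `μ` in the order of the list, each
with a favorite leftover, one at a time if what they get is not privately owned by an agent who has
not left, or else along a cycle of private objects. -/
inductive Schedule (Γ : Economy I O) (own : O → Option I) (μ : I → Option O) : List I → Prop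
  | nil : Schedule Γ own μ []
  | single {l : List I} (i : I) (prev : Schedule Γ own μ l) (not_mem : i ∉ l)
      (best : Γ.IsBest i (leftOver μ {j | j ∈ l}) (μ i))
      (free : ∀ o m, μ i = some o → own o = some m → m ∈ l) : Schedule Γ own μ (l ++ [i])
  | cycle {l : List I} (a : I) (b : List I) (next : I → I) (prev : Schedule Γ own μ l)
      (nodup : (a :: b).Nodup) (not_mem : ∀ i ∈ a :: b, i ∉ l)
      (best : ∀ i ∈ a :: b, Γ.IsBest i (leftOver μ {j | j ∈ l}) (μ i))
      (owned : ∀ i ∈ a :: b, ∃ o, μ i = some o ∧ own o = some (next i))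
      (next_mem : ∀ i ∈ a :: b, next i ∈ a :: b)
      (minimal : ∀ V ⊆ {i | i ∈ a :: b}, V.Nonempty → (∀ i ∈ V, next i ∈ V) →
        V = {i | i ∈ a :: b}) : Schedule Γ own μ (l ++ a :: b)

theorem Schedule.nodup {Γ : Economy I O} {own : O → Option I} {μ : I → Option O} {l : List I}
    (h : Γ.Schedule own μ l) : l.Nodup := by
  induction h with
  | nil => exact List.nodup_nil
  | single i _ hi _ _ ih => exact List.nodup_append'.mpr ⟨ih, by simp, by simpa using hi⟩
  | cycle a b next _ hb hl _ _ _ _ ih =>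
    exact List.nodup_append'.mpr ⟨ih, hb, fun i hi hib => hl i hib hi⟩

theorem Schedule.closed {Γ : Economy I O} {own : O → Option I} {μ : I → Option O} {l : List I}
    (h : Γ.Schedule own μ l) :
    ∀ i ∈ l, ∀ o m, μ i = some o → own o = some m → m ∈ l := by
  induction h with
  | nil => simp
  | single i _ _ _ hf ih =>
    intro k hk o m hko hm
    rcases List.mem_append.mp hk with hk | hk
    · exact List.mem_append_left _ (ih k hk o m hko hm)
    · rw [List.mem_singleton] at hk
      subst hk
      exact List.mem_append_left _ (hf o m hko hm)
  | cycle a b next _ _ _ _ ho hn _ ih =>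
    intro k hk o m hko hm
    rcases List.mem_append.mp hk with hk | hk
    · exact List.mem_append_left _ (ih k hk o m hko hm)
    · obtain ⟨o', h1, h2⟩ := ho k hk
      cases hko.symm.trans h1
      cases hm.symm.trans h2
      exact List.mem_append_right _ (hn k hk)

/-- The agents of the cycle already have what they ask for. One whose object has no remaining
private owner can leave alone; if there is no such agent, everyone asks the private owner of her own
assignment and the whole cycle leaves. -/
theorem Schedule.exists_append [Finite I] {Γ : Economy I O} {own : O → Option I}
    {μ : I → Option O} (hμ : IsAllocation μ) {l : List I} (h : Γ.Schedule own μ l) {Z : Set I}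
    {x : I → Option O} {next : I → I} (hZ : Γ.TradingCycle own μ {j | j ∈ l} Z x next)
    (hx : ∀ i ∈ Z, x i = μ i) : ∃ b, b ≠ [] ∧ Γ.Schedule own μ (l ++ b) := by
  have hbest : ∀ i ∈ Z, Γ.IsBest i (leftOver μ {j | j ∈ l}) (μ i) := fun i hi =>
    hx i hi ▸ hZ.best i hi
  by_cases hfree : ∃ i ∈ Z, ∀ o m, μ i = some o → own o = some m → m ∈ l
  · obtain ⟨i, hi, hfree⟩ := hfree
    exact ⟨[i], by simp, h.single i (hZ.not_mem i hi) (hbest i hi) hfree⟩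
  · push Not at hfree
    have hmem : ∀ i, i ∈ Z.toFinite.toFinset.toList ↔ i ∈ Z := by simp
    have hnd : Z.toFinite.toFinset.toList.Nodup := Finset.nodup_toList _
    rcases hb : Z.toFinite.toFinset.toList with _ | ⟨a, b⟩
    · obtain ⟨i, hi⟩ := hZ.nonempty
      rw [← hmem, hb] at hi
      exact absurd hi List.not_mem_nil
    rw [hb] at hmem hnd
    have hset : {i | i ∈ a :: b} = Z := Set.ext hmem
    refine ⟨a :: b, by simp, Schedule.cycle a b next h hnd (fun i hi => ?_) (fun i hi => ?_)
      (fun i hi => ?_) (fun i hi => ?_) ?_⟩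
    · exact hZ.not_mem i ((hmem i).mp hi)
    · exact hbest i ((hmem i).mp hi)
    · have hi := (hmem i).mp hi
      rcases hZ.asks_of_eq hμ hi (hx i hi) with ⟨o, h1, h2, -⟩ | ⟨h1, -⟩
      · exact ⟨o, h1, h2⟩
      · obtain ⟨o, m, h2, h3, h4⟩ := hfree i hi
        exact absurd (h1 o m h2 h3) h4
    · exact (hmem _).mpr (hZ.next_mem i ((hmem i).mp hi))
    · rw [hset]
      exact hZ.minimal

theorem exists_schedule [Finite I] [Finite O] {Γ : Economy I O} {own : O → Option I}
    {μ : I → Option O} (hμ : IsAllocation μ)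
    (hstable : ∀ (S Z : Set I) (x : I → Option O) (next : I → I),
      (∀ i ∈ S, ∀ o m, μ i = some o → own o = some m → m ∈ S) →
      Γ.TradingCycle own μ S Z x next → ∀ i ∈ Z, x i = μ i) :
    ∃ l, Γ.Schedule own μ l ∧ ∀ i, i ∈ l := by
  classical
  have := Fintype.ofFinite I
  -- This picks a longest schedule; a schedule has no repetitions, so the subtraction is not
  -- truncated.
  obtain ⟨l, hl, hmax⟩ := exists_min_nat (fun l : List I => Fintype.card I - l.length)
    (Γ.Schedule own μ) ⟨[], Schedule.nil⟩
  refine ⟨l, hl, ?_⟩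
  by_contra hcon
  push Not at hcon
  obtain ⟨Z, x, next, hZ⟩ := Γ.exists_tradingCycle own μ (S := {j | j ∈ l}) hcon
  obtain ⟨b, hb, hlb⟩ := hl.exists_append hμ hZ (hstable _ Z x next hl.closed hZ)
  have h1 := hmax _ hlb
  have h2 := hlb.nodup.length_le_card
  have h3 := List.length_pos_iff.mpr hb
  simp only [List.length_append] at h1 h2
  omega

theorem exists_schedule_of_mem_exclusionCore [Finite I] [Finite O] {Γ : Economy I O}
    {own : O → Option I} (h : Γ.OwnedBy own) {μ : I → Option O} (hμ : μ ∈ Γ.exclusionCore) :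
    ∃ l, Γ.Schedule own μ l ∧ ∀ i, i ∈ l := by
  refine exists_schedule hμ.1 fun S Z x next _ hZ => ?_
  by_contra hcon
  push Not at hcon
  exact hZ.exclusionBlocked h hμ.1 hcon hμ

theorem exists_schedule_of_mem_rectifiedCoreStar [Finite I] [Finite O] {Γ : Economy I O}
    {own : O → Option I} (h : Γ.OwnedBy own) {p : LinearOrder (Option O)}
    (hp : ∀ o : O, p.lt (some o) none) {μ : I → Option O} (hμ : μ ∈ Γ.rectifiedCoreStar p) :
    ∃ l, Γ.Schedule own μ l ∧ ∀ i, i ∈ l := by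
  obtain ⟨ν, hν, rfl⟩ := hμ
  have hnone : ν none = none := by
    by_contra hne
    -- If `i*` held an object, she alone would block by giving it up.
    refine hν.2 ⟨{none}, fun _ => none, ⟨none, rfl⟩, fun _ _ _ hi => (nomatch hi), ⟨?_, ?_⟩, ?_, ?_⟩
    · rintro _ rfl
      obtain ⟨o, ho⟩ := Option.ne_none_iff_exists'.mp hne
      rw [ho]
      exact Or.inr (hp o)
    · refine ⟨none, rfl, ?_⟩
      obtain ⟨o, ho⟩ := Option.ne_none_iff_exists'.mp hne
      rw [ho]
      exact hp o
    · exact fun _ _ _ hi => nomatch hi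
    · exact fun _ _ _ _ _ _ _ _ hi => nomatch hi
  have hμ : IsAllocation fun i => ν (some i) := fun i j o hi hj =>
    Option.some.inj (hν.1 _ _ o hi hj)
  refine exists_schedule hμ fun S Z x next hS hZ => ?_
  by_contra hcon
  push Not at hcon
  exact hZ.rectificationBlocked h p hμ hS hcon (fun _ => rfl) hnone hν

end Economy

/-! ### Sharing, arcs and cycles in the mechanism -/

namespace Economy

variable {I O : Type*}

/-! ### The arcs of the objects -/

theorem mem_of_highest {r : List I} {S : Set I} {j : I} (h : highest r S = some j) : j ∈ S := by
  simpa using List.find?_some h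

theorem highest_eq_none {r : List I} {S : Set I} (h : ∀ i ∈ r, i ∉ S) : highest r S = none := by
  simpa [highest] using h

theorem not_mem_of_highest_eq_none {r : List I} {S : Set I} (h : highest r S = none) :
    ∀ i ∈ r, i ∉ S := by
  simpa [highest] using h

/-- A maintained arc still leads to the highest holder when other holders leave. -/
theorem highest_of_subset {r : List I} {S S' : Set I} {j : I} (h : highest r S = some j)
    (hS : S' ⊆ S) (hj : j ∈ S') : highest r S' = some j := by
  classical
  unfold highest at h ⊢
  rw [List.find?_eq_some_iff_append] at h ⊢
  obtain ⟨-, as, bs, h1, h2⟩ := h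
  refine ⟨by simpa using hj, as, bs, h1, fun a ha => ?_⟩
  have h3 : a ∉ S := by simpa using h2 a ha
  simpa using fun ha' => h3 (hS ha')

theorem highest_singleton {r : List I} {m : I} (hm : m ∈ r) : highest r {m} = some m := by
  rcases h : highest r {m} with _ | j
  · exact absurd rfl (not_mem_of_highest_eq_none h m hm)
  · exact congrArg some (Set.mem_singleton_iff.mp (mem_of_highest h))

theorem highest_append_cons {l l' : List I} {i : I} {S : Set I} (hl : ∀ k ∈ l, k ∉ S)
    (hi : i ∈ S) : highest (l ++ i :: l') S = some i := by
  unfold highest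
  rw [List.find?_append, List.find?_eq_none.mpr (by simpa using hl)]
  simp [hi]

/-- The remaining holders of an object are nobody, its remaining private owner, or all remaining
agents, and the object points to the highest of them. -/
structure PointerInvariant (Γ : Economy I O) (own : O → Option I) (r : List I) (s : YState I O) :
    Prop where
  sharers_public : ∀ o, own o = none → remSharers s o = ∅
  sharers_owned : ∀ o m, own o = some m → m ∈ s.order → remSharers s o = ∅
  sharers_left : ∀ o m, own o = some m → m ∉ s.order →
    remSharers s o = ∅ ∨ remSharers s o = {i | i ∈ s.order}
  pointer_eq : ∀ o, Γ.pointer r s o = highest r (Γ.remHolders s o)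

variable {Γ : Economy I O} {own : O → Option I} {r : List I} {s s' : YState I O}

theorem OwnedBy.remOwners_public (h : Γ.OwnedBy own) {o : O} (ho : own o = none) :
    Γ.remOwners s o = {i | i ∈ s.order} := by
  simp [remOwners, h.eq_univ ho]

theorem OwnedBy.remOwners_owned (h : Γ.OwnedBy own) {o : O} {m : I} (ho : own o = some m)
    (hm : m ∈ s.order) : Γ.remOwners s o = {m} := by
  ext i
  simp only [remOwners, h.single ho, Set.mem_ofPred_eq, Set.mem_singleton_iff]
  exact ⟨fun hi => hi.2, fun hi => ⟨hi ▸ hm, hi⟩⟩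

theorem OwnedBy.remOwners_left (h : Γ.OwnedBy own) {o : O} {m : I} (ho : own o = some m)
    (hm : m ∉ s.order) : Γ.remOwners s o = ∅ := by
  ext i
  simp only [remOwners, h.single ho, Set.mem_ofPred_eq, Set.mem_singleton_iff,
    Set.mem_empty_iff_false, iff_false]
  rintro ⟨h1, rfl⟩
  exact hm h1

theorem mem_order_of_mem_remHolders {o : O} {i : I} (h : i ∈ Γ.remHolders s o) : i ∈ s.order :=
  h.elim (fun h => h.1) fun h => h.1

namespace PointerInvariant

theorem remHolders_public (hs : Γ.PointerInvariant own r s) (h : Γ.OwnedBy own) {o : O}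
    (ho : own o = none) : Γ.remHolders s o = {i | i ∈ s.order} := by
  rw [remHolders, h.remOwners_public ho, hs.sharers_public o ho, Set.union_empty]

theorem remHolders_owned (hs : Γ.PointerInvariant own r s) (h : Γ.OwnedBy own) {o : O} {m : I}
    (ho : own o = some m) (hm : m ∈ s.order) : Γ.remHolders s o = {m} := by
  rw [remHolders, h.remOwners_owned ho hm, hs.sharers_owned o m ho hm, Set.union_empty]

theorem remHolders_left (hs : Γ.PointerInvariant own r s) (h : Γ.OwnedBy own) {o : O} {m : I}
    (ho : own o = some m) (hm : m ∉ s.order) :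
    Γ.remHolders s o = ∅ ∨ Γ.remHolders s o = {i | i ∈ s.order} := by
  rw [remHolders, h.remOwners_left ho hm, Set.empty_union]
  exact hs.sharers_left o m ho hm

theorem pointer_owned (hs : Γ.PointerInvariant own r s) (h : Γ.OwnedBy own) (hr : ∀ i, i ∈ r)
    {o : O} {m : I} (ho : own o = some m) (hm : m ∈ s.order) : Γ.pointer r s o = some m := by
  rw [hs.pointer_eq, hs.remHolders_owned h ho hm, highest_singleton (hr m)]

theorem mem_remHolders (hs : Γ.PointerInvariant own r s) {o : O} {j : I}
    (hj : Γ.pointer r s o = some j) : j ∈ Γ.remHolders s o := by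
  rw [hs.pointer_eq] at hj
  exact mem_of_highest hj

theorem mem_order (hs : Γ.PointerInvariant own r s) {o : O} {j : I}
    (hj : Γ.pointer r s o = some j) : j ∈ s.order :=
  mem_order_of_mem_remHolders (hs.mem_remHolders hj)

/-- The hypothesis `hsh` describes how sharing can evolve: nothing changes for the remaining agents,
or the private owner has just left and everybody remaining becomes a sharer. In the second case the
old arc led to that owner and is redrawn. -/
theorem next (hs : Γ.PointerInvariant own r s) (h : Γ.OwnedBy own) (hr : ∀ i, i ∈ r)
    (hord : ∀ i ∈ s'.order, i ∈ s.order) (harc : s'.objectArc = Γ.pointer r s)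
    (hsh : ∀ o, (∀ k ∈ s'.order, k ∈ s'.shared o ↔ k ∈ s.shared o) ∨
      (∃ m, own o = some m ∧ m ∈ s.order ∧ m ∉ s'.order) ∧ ∀ k ∈ s'.order, k ∈ s'.shared o) :
    Γ.PointerInvariant own r s' := by
  have hsame : ∀ o, (∀ k ∈ s'.order, k ∈ s'.shared o ↔ k ∈ s.shared o) →
      remSharers s' o = {k | k ∈ s'.order ∧ k ∈ remSharers s o} := by
    intro o ho
    ext k
    exact ⟨fun hk => ⟨hk.1, hord k hk.1, (ho k hk.1).mp hk.2⟩,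
      fun hk => ⟨hk.1, (ho k hk.1).mpr hk.2.2⟩⟩
  have h1 : ∀ o, own o = none → remSharers s' o = ∅ := by
    intro o ho
    rcases hsh o with h1 | ⟨⟨m, h1, -⟩, -⟩
    · rw [hsame o h1, hs.sharers_public o ho]
      simp
    · cases ho.symm.trans h1
  have h2 : ∀ o m, own o = some m → m ∈ s'.order → remSharers s' o = ∅ := by
    intro o m ho hm
    rcases hsh o with h1 | ⟨⟨m', h1, -, h2⟩, -⟩
    · rw [hsame o h1, hs.sharers_owned o m ho (hord m hm)]
      simp
    · cases ho.symm.trans h1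
      exact absurd hm h2
  have h3 : ∀ o m, own o = some m → m ∉ s'.order →
      remSharers s' o = ∅ ∨ remSharers s' o = {i | i ∈ s'.order} := by
    intro o m ho hm
    rcases hsh o with h1 | ⟨-, h1⟩
    · rw [hsame o h1]
      by_cases hm' : m ∈ s.order
      · rw [hs.sharers_owned o m ho hm']
        simp
      · rcases hs.sharers_left o m ho hm' with h2 | h2 <;> rw [h2]
        · simp
        · exact Or.inr (Set.ext fun i => ⟨fun hi => hi.1, fun hi => ⟨hi, hord i hi⟩⟩)
    · exact Or.inr (Set.ext fun i => ⟨fun hi => hi.1, fun hi => ⟨hi, h1 i hi⟩⟩)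
  have hempty : highest r (∅ : Set I) = none := highest_eq_none fun _ _ h => h
  -- Owners and sharers never remain together, so preferring owners to sharers selects the highest
  -- holder.
  have hor : ∀ o, (highest r (Γ.remOwners s' o)).or (highest r (remSharers s' o)) =
      highest r (Γ.remHolders s' o) := by
    intro o
    rw [remHolders]
    rcases ho : own o with _ | m
    · rw [h1 o ho, Set.union_empty, hempty, Option.or_none]
    · by_cases hm : m ∈ s'.order
      · rw [h2 o m ho hm, Set.union_empty, hempty, Option.or_none]
      · rw [h.remOwners_left ho hm, Set.empty_union, hempty, Option.none_or]
  refine ⟨h1, h2, h3, fun o => ?_⟩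
  unfold pointer
  rw [harc]
  rcases hsh o with hsh | ⟨⟨m, hm, hms, hms'⟩, -⟩
  · have hH : Γ.remHolders s' o = {k | k ∈ s'.order ∧ k ∈ Γ.remHolders s o} := by
      ext k
      rw [remHolders, hsame o hsh]
      constructor
      · rintro (hk | hk)
        · exact ⟨hk.1, Or.inl ⟨hord k hk.1, hk.2⟩⟩
        · exact ⟨hk.1, Or.inr hk.2⟩
      · rintro ⟨hk, hk' | hk'⟩
        · exact Or.inl ⟨hk, hk'.2⟩
        · exact Or.inr ⟨hk, hk'⟩
    rw [hs.pointer_eq o]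
    rcases hj : highest r (Γ.remHolders s o) with _ | j
    · refine (highest_eq_none fun i _ hi => ?_).symm
      rw [hH] at hi
      exact not_mem_of_highest_eq_none hj i (hr i) hi.2
    · by_cases hjo : j ∈ s'.order
      · simp only [if_pos hjo]
        refine (highest_of_subset hj ?_ ?_).symm
        · rw [hH]
          exact fun k hk => hk.2
        · rw [hH]
          exact ⟨hjo, mem_of_highest hj⟩
      · simp only [if_neg hjo]
        exact hor o
  · rw [hs.pointer_owned h hr hm hms]
    simp only [if_neg hms']
    exact hor o

end PointerInvariant

theorem pointerInvariant_init (hr : ∀ i, i ∈ r) :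
    Γ.PointerInvariant own r (Γ.yInit r) := by
  have hsh : ∀ o, remSharers (Γ.yInit r) o = ∅ := fun o => by
    simp [remSharers, yInit]
  have hH : ∀ o, Γ.remHolders (Γ.yInit r) o = Γ.owners o := fun o => by
    rw [remHolders, hsh, Set.union_empty]
    simp [remOwners, yInit, hr]
  refine ⟨fun o _ => hsh o, fun o _ _ _ => hsh o, fun o _ _ _ => Or.inl (hsh o), fun o => ?_⟩
  rw [hH]
  unfold pointer
  simp only [yInit]
  rcases hj : highest r (Γ.owners o) with _ | j
  · rfl
  · simp [hr]

/-! ### Cycles -/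

variable {arc : I → Option O} {i : I}

theorem Link.eq {j k k' : I} (h : Γ.Link r s arc j k) (h' : Γ.Link r s arc j k') : k = k' := by
  obtain ⟨-, o, -, h1, h2⟩ := h
  obtain ⟨-, o', -, h3, h4⟩ := h'
  cases h1.symm.trans h3
  exact Option.some.inj (h2.symm.trans h4)

theorem exists_link_of_mem_cycleAgents {k : I} (hk : k ∈ Γ.cycleAgents r s arc i) :
    ∃ k' ∈ Γ.cycleAgents r s arc i, Γ.Link r s arc k k' := by
  obtain ⟨h1, h2⟩ := hk
  obtain ⟨k', h3, h4⟩ := Relation.TransGen.head'_iff.mp h2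
  refine ⟨k', ⟨h1.tail h3, ?_⟩, h3⟩
  rcases Relation.reflTransGen_iff_eq_or_transGen.mp h4 with h5 | h5
  · subst h5
    exact h1.tail h3
  · exact h5

theorem exists_link_to_of_mem_cycleAgents {k : I} (hk : k ∈ Γ.cycleAgents r s arc i) :
    ∃ k' ∈ Γ.cycleAgents r s arc i, Γ.Link r s arc k' k := by
  obtain ⟨h1, h2⟩ := hk
  obtain ⟨k', h3, h4⟩ := Relation.TransGen.tail'_iff.mp h1
  refine ⟨k', ⟨?_, Relation.TransGen.head h4 h2⟩, h4⟩
  rcases Relation.reflTransGen_iff_eq_or_transGen.mp h3 with h5 | h5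
  · subst h5
    exact Relation.TransGen.head h4 h2
  · exact h5

theorem mem_order_of_mem_cycleAgents {k : I} (hk : k ∈ Γ.cycleAgents r s arc i) : k ∈ s.order := by
  obtain ⟨_, -, h⟩ := exists_link_of_mem_cycleAgents hk
  exact h.1

theorem exists_pointer_of_mem_cycleObjects {b : O} (hb : b ∈ Γ.cycleObjects r s arc i) :
    ∃ j ∈ Γ.cycleAgents r s arc i, Γ.pointer r s b = some j := by
  obtain ⟨k, hk, hkb⟩ := hb
  obtain ⟨j, hj, -, o, -, h1, h2⟩ := exists_link_of_mem_cycleAgents hk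
  cases hkb.symm.trans h1
  exact ⟨j, hj, h2⟩

/-- The successor map sends the finite cycle onto itself, so it is injective, and agents pointing to
the same object have the same successor. -/
theorem cycle_arc_injOn [Finite I] {k k' : I} {o : O} (hk : k ∈ Γ.cycleAgents r s arc i)
    (hk' : k' ∈ Γ.cycleAgents r s arc i) (ho : arc k = some o) (ho' : arc k' = some o) :
    k = k' := by
  have hf : ∀ k, ∃ n, k ∈ Γ.cycleAgents r s arc i →
      n ∈ Γ.cycleAgents r s arc i ∧ Γ.Link r s arc k n := by
    intro k
    by_cases hk : k ∈ Γ.cycleAgents r s arc i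
    · obtain ⟨n, hn⟩ := exists_link_of_mem_cycleAgents hk
      exact ⟨n, fun _ => hn⟩
    · exact ⟨k, fun h => absurd h hk⟩
  choose f hf using hf
  have him : f '' Γ.cycleAgents r s arc i = Γ.cycleAgents r s arc i := by
    apply Set.Subset.antisymm
    · rintro _ ⟨k, hk, rfl⟩
      exact (hf k hk).1
    · intro z hz
      obtain ⟨y, hy, hyz⟩ := exists_link_to_of_mem_cycleAgents hz
      exact ⟨y, hy, (hf y hy).2.eq hyz⟩
  refine Set.injOn_of_ncard_image_eq (by rw [him]) (Set.toFinite _) hk hk' ?_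
  obtain ⟨-, o1, -, h1, h2⟩ := (hf k hk).2
  obtain ⟨-, o2, -, h3, h4⟩ := (hf k' hk').2
  cases ho.symm.trans h1
  cases ho'.symm.trans h3
  exact Option.some.inj (h2.symm.trans h4)

/-- Only a trade affects sharing. If some object of the cycle is held by everybody, the private
objects of the leaving owners become shared by all. Otherwise each object of the cycle is held only
by its private owner, who leaves, so nobody remaining gains a share. -/
theorem PointerInvariant.step (hs : Γ.PointerInvariant own r s) (h : Γ.OwnedBy own)
    (hr : ∀ i, i ∈ r) (hstep : Γ.YStep r s s') : Γ.PointerInvariant own r s' := by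
  classical
  cases hstep with
  | obtain i rest x top fav unheld =>
    refine hs.next h hr (fun k hk => ?_) rfl fun o => Or.inl fun _ _ => Iff.rfl
    rw [top]
    exact List.mem_cons_of_mem _ hk
  | request i rest o j arc top fav held arc_eq no_cycle =>
    refine hs.next h hr (fun k hk => ?_) rfl fun o => Or.inl fun _ _ => Iff.rfl
    rcases List.mem_cons.mp hk with rfl | hk
    · exact hs.mem_order held
    · exact List.mem_of_mem_filter hk
  | trade i rest o arc top fav arc_eq cycle =>
    set K := Γ.cycleAgents r s arc i with hK
    set B := Γ.cycleObjects r s arc i with hB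
    have hord : ∀ k ∈ s.order.filter (fun k => decide (k ∉ K)), k ∈ s.order ∧ k ∉ K := by
      intro k hk
      simpa using hk
    refine hs.next h hr (fun k hk => (hord k hk).1) rfl fun a => ?_
    have hleft : (∀ k ∈ s.order, k ∉ K → k ∉ Γ.remHolders s a → ∀ j ∈ K, j ∈ Γ.remHolders s a →
        ∀ b ∈ B, k ∉ Γ.remHolders s b) → ∀ k ∈ s.order.filter (fun k => decide (k ∉ K)),
        k ∈ Γ.newShared s K B a ↔ k ∈ s.shared a := by
      intro hno k hk
      refine ⟨?_, fun hk' => Or.inl hk'⟩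
      rintro (hk' | ⟨h1, h2, j, h3, h4, b, h5, h6⟩)
      · exact hk'
      · exact absurd h6 (hno k (hord k hk).1 h1 h2 j h3 h4 b h5)
    by_cases hfull : ∃ b ∈ B, Γ.remHolders s b = {i | i ∈ s.order}
    · obtain ⟨b, hb, hbH⟩ := hfull
      rcases ha : own a with _ | m
      · refine Or.inl (hleft fun k hk _ hka => absurd ?_ hka)
        rw [hs.remHolders_public h ha]
        exact hk
      by_cases hm : m ∈ s.order
      · have haH := hs.remHolders_owned h ha hm
        by_cases hmK : m ∈ K
        · refine Or.inr ⟨⟨m, rfl, hm, fun hm' => (hord m hm').2 hmK⟩, fun k hk => Or.inr ?_⟩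
          refine ⟨(hord k hk).2, ?_, m, hmK, ?_, b, hb, ?_⟩
          · rw [haH]
            rintro rfl
            exact (hord k hk).2 hmK
          · rw [haH]
            rfl
          · rw [hbH]
            exact (hord k hk).1
        · refine Or.inl (hleft fun k _ _ _ j hj hja => absurd ?_ hmK)
          rw [haH] at hja
          cases hja
          exact hj
      · rcases hs.remHolders_left h ha hm with haH | haH
        · refine Or.inl (hleft fun k _ _ _ j hj hja => absurd hja ?_)
          rw [haH]
          exact id
        · refine Or.inl (hleft fun k hk _ hka => absurd ?_ hka)
          rw [haH]
          exact hk
    · push Not at hfull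
      refine Or.inl (hleft fun k _ hkK _ _ _ _ b hb hkb => ?_)
      obtain ⟨j, hj, hjb⟩ := exists_pointer_of_mem_cycleObjects hb
      have hjH := hs.mem_remHolders hjb
      rcases ho : own b with _ | m
      · exact hfull b hb (hs.remHolders_public h ho)
      · by_cases hm : m ∈ s.order
        · rw [hs.remHolders_owned h ho hm] at hjH hkb
          cases hjH
          cases hkb
          exact hkK hj
        · rcases hs.remHolders_left h ho hm with hH | hH
          · rw [hH] at hkb
            exact hkb
          · exact hfull b hb hH

end Economy

namespace Economy

variable {I O : Type*} {Γ : Economy I O} {own : O → Option I} {r : List I} {s : YState I O}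
  {μ : I → Option O}

/-! ### Running a schedule -/

/-- The agents of `l` have left with their assignments at `μ`, those of `rest` remain, in this order
and without arcs. -/
structure Ready (Γ : Economy I O) (own : O → Option I) (μ : I → Option O) (r l rest : List I)
    (s : YState I O) : Prop where
  inv : Γ.PointerInvariant own r s
  order_eq : s.order = rest
  mem_objects : ∀ o, o ∈ s.objects ↔ ∀ j ∈ l, μ j ≠ some o
  assigned_eq : ∀ k ∈ l, s.assigned k = μ k
  arc_eq_none : ∀ k ∈ rest, s.agentArc k = none

theorem IsBest.isFavorite {l : List I} {i : I} {x : Option O}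
    (h : Γ.IsBest i (leftOver μ {j | j ∈ l}) x)
    (hs : ∀ o, o ∈ s.objects ↔ ∀ j ∈ l, μ j ≠ some o) : Γ.IsFavorite s i x :=
  ⟨fun o ho => (hs o).mpr fun j hj => h.1 j hj o ho,
    fun y hy => h.2 y fun j hj o ho => (hs o).mp (hy o ho) j hj⟩

/-- With no remaining private owner, the object wanted by `i` is held by nobody or by everybody. In
the latter case it points to `i`, the highest remaining agent in `r`, and `i` forms a cycle by
herself. -/
theorem Ready.single {l rest : List I} {i : I} (hs : Γ.Ready own μ r l (i :: rest) s)
    (h : Γ.OwnedBy own) (hr : r = l ++ i :: rest) (hall : ∀ i, i ∈ r) (hnd : r.Nodup)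
    (best : Γ.IsBest i (leftOver μ {j | j ∈ l}) (μ i))
    (free : ∀ o m, μ i = some o → own o = some m → m ∈ l) :
    ∃ s', Γ.YStep r s s' ∧ Γ.Ready own μ r (l ++ [i]) rest s' := by
  classical
  have hfav : Γ.IsFavorite s i (μ i) := best.isFavorite hs.mem_objects
  have hdisj : ∀ k ∈ l, k ∉ i :: rest := by
    rw [hr] at hnd
    exact fun k hk hk' => (List.nodup_append'.mp hnd).2.2 hk hk'
  have hil : i ∉ l := fun hi => hdisj i hi List.mem_cons_self
  have hirest : i ∉ rest := by
    rw [hr] at hnd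
    exact (List.nodup_cons.mp (List.nodup_append'.mp hnd).2.1).1
  by_cases hun : ∀ o, μ i = some o → Γ.pointer r s o = none
  · have hstep := YStep.obtain s i rest (μ i) hs.order_eq hfav hun
    refine ⟨_, hstep, hs.inv.step h hall hstep, rfl, fun o => ?_, fun k hk => ?_, fun k hk => ?_⟩
    · simp only [Set.mem_sdiff, hs.mem_objects, Set.mem_ofPred_eq, List.mem_append,
        List.mem_singleton]
      constructor
      · rintro ⟨h1, h2⟩ j (hj | rfl)
        · exact h1 j hj
        · exact h2
      · exact fun h1 => ⟨fun j hj => h1 j (Or.inl hj), h1 i (Or.inr rfl)⟩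
    · by_cases hki : k = i
      · subst hki
        simp
      · have hkl : k ∈ l := by simpa [hki] using hk
        simpa [hki] using hs.assigned_eq k hkl
    · exact hs.arc_eq_none k (List.mem_cons_of_mem _ hk)
  · push Not at hun
    obtain ⟨o, ho, hpo⟩ := hun
    have hpoint : Γ.pointer r s o = some i := by
      rw [hs.inv.pointer_eq] at hpo ⊢
      have hH : Γ.remHolders s o = {i | i ∈ s.order} := by
        rcases hm : own o with _ | m
        · exact hs.inv.remHolders_public h hm
        · have hml : m ∉ s.order := by
            rw [hs.order_eq]
            exact hdisj m (free o m ho hm)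
          refine (hs.inv.remHolders_left h hm hml).resolve_left fun hH => hpo ?_
          rw [hH]
          exact highest_eq_none fun _ _ h => h
      rw [hH, hr, hs.order_eq]
      exact highest_append_cons hdisj List.mem_cons_self
    rw [ho] at hfav
    set arc := Function.update s.agentArc i (some o) with harc
    have harci : arc i = some o := Function.update_self ..
    have hlink : Γ.Link r s arc i i :=
      ⟨by rw [hs.order_eq]; exact List.mem_cons_self, o, hfav.1 o rfl, harci, hpoint⟩
    have hreach : ∀ k, Relation.TransGen (Γ.Link r s arc) i k → k = i := by
      intro k hk
      induction hk with
      | single hk => exact hk.eq hlink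
      | tail _ hk ih =>
        subst ih
        exact hk.eq hlink
    have hK : ∀ k, k ∈ Γ.cycleAgents r s arc i ↔ k = i := by
      refine fun k => ⟨fun hk => hreach k hk.1, ?_⟩
      rintro rfl
      exact ⟨.single hlink, .single hlink⟩
    have hstep := YStep.trade s i rest o arc hs.order_eq hfav harc (.single hlink)
    refine ⟨_, hstep, hs.inv.step h hall hstep, ?_, fun o' => ?_, fun k hk => ?_, fun k hk => ?_⟩
    · simp only [hK, hs.order_eq]
      rw [List.filter_cons_of_neg (by simp), List.filter_eq_self]
      intro k hk
      simpa using ne_of_mem_of_not_mem hk hirest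
    · simp only [Set.mem_sdiff, hs.mem_objects, cycleObjects, hK, Set.mem_ofPred_eq,
        List.mem_append, List.mem_singleton, exists_eq_left]
      rw [harci, ← ho]
      constructor
      · rintro ⟨h1, h2⟩ j (hj | rfl)
        · exact h1 j hj
        · exact h2
      · exact fun h1 => ⟨fun j hj => h1 j (Or.inl hj), h1 i (Or.inr rfl)⟩
    · simp only [hK]
      split_ifs with hki
      · rw [hki, harci, ho]
      · exact hs.assigned_eq k (by simpa [hki] using hk)
    · have hki : k ≠ i := ne_of_mem_of_not_mem hk hirest
      exact (Function.update_of_ne hki ..).trans (hs.arc_eq_none k (List.mem_cons_of_mem _ hk))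

/-- While a cycle of private objects with the agents `b` is being formed, the agents of `V` have
made their requests, and agent `c` is on top. -/
structure Forming (Γ : Economy I O) (own : O → Option I) (μ : I → Option O) (next : I → I)
    (r l b rest : List I) (V : Set I) (c : I) (s : YState I O) : Prop where
  inv : Γ.PointerInvariant own r s
  top : ∃ tl, s.order = c :: tl
  top_mem : c ∈ b
  top_not_mem : c ∉ V
  visited_mem : ∀ v ∈ V, v ∈ b
  next_visited : ∀ v ∈ V, next v = c ∨ next v ∈ V
  mem_order : ∀ i ∈ b, i ∈ s.order
  filter_order : ∀ (K : I → Bool), (∀ k, K k = true ↔ k ∉ b) → s.order.filter K = rest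
  mem_objects : ∀ o, o ∈ s.objects ↔ ∀ j ∈ l, μ j ≠ some o
  assigned_eq : ∀ k ∈ l, s.assigned k = μ k
  arc_eq : ∀ k ∈ V, s.agentArc k = μ k
  arc_eq_none : ∀ k ∈ s.order, k ∉ V → s.agentArc k = none

/-- Each request brings the owner `next c` to the top, until one of the agents who have already
pointed is reached. Those agents are then invariant under `next`, so by minimality they are all of
`b`. The number `n` bounds the agents still outside `V`. -/
theorem Forming.exists_ready [Finite I] (h : Γ.OwnedBy own) (hall : ∀ i, i ∈ r) {next : I → I}
    {l b rest : List I} (hbr : ∀ i ∈ b, i ∉ rest)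
    (best : ∀ i ∈ b, Γ.IsBest i (leftOver μ {j | j ∈ l}) (μ i))
    (owned : ∀ i ∈ b, ∃ o, μ i = some o ∧ own o = some (next i))
    (next_mem : ∀ i ∈ b, next i ∈ b)
    (minimal : ∀ V ⊆ {i | i ∈ b}, V.Nonempty → (∀ i ∈ V, next i ∈ V) → V = {i | i ∈ b})
    (n : ℕ) : ∀ (V : Set I) (c : I) (s : YState I O), Vᶜ.ncard ≤ n →
      Γ.Forming own μ next r l b rest V c s →
      ∃ s', Relation.ReflTransGen (Γ.YStep r) s s' ∧ Γ.Ready own μ r (l ++ b) rest s' := by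
  classical
  induction n with
  | zero =>
    intro V c s hn hs
    have : c ∈ Vᶜ := hs.top_not_mem
    rw [(Set.ncard_eq_zero (Set.toFinite _)).mp (Nat.le_zero.mp hn)] at this
    exact absurd this id
  | succ n ih =>
    intro V c s hn hs
    obtain ⟨tl, htl⟩ := hs.top
    obtain ⟨o, hco, hoc⟩ := owned c hs.top_mem
    have hfav : Γ.IsFavorite s c (some o) := hco ▸ (best c hs.top_mem).isFavorite hs.mem_objects
    set arc := Function.update s.agentArc c (some o) with harc
    have harcc : arc c = some o := Function.update_self ..
    have harcV : ∀ k ∈ insert c V, arc k = μ k := by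
      rintro k (rfl | hk)
      · rw [harcc, hco]
      · rw [← hs.arc_eq k hk]
        exact Function.update_of_ne (ne_of_mem_of_not_mem hk hs.top_not_mem) ..
    have harcn : ∀ k ∈ s.order, k ∉ insert c V → arc k = none := by
      intro k hk hkV
      rw [← hs.arc_eq_none k hk fun hkV' => hkV (Or.inr hkV')]
      exact Function.update_of_ne (fun hkc => hkV (Or.inl hkc)) ..
    have hpoint : ∀ k ∈ b, ∀ o, own o = some (next k) → Γ.pointer r s o = some (next k) :=
      fun k hk o ho => hs.inv.pointer_owned h hall ho (hs.mem_order _ (next_mem k hk))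
    have hlink : ∀ k ∈ insert c V, Γ.Link r s arc k (next k) := by
      intro k hk
      have hkb : k ∈ b := hk.elim (fun hk => hk ▸ hs.top_mem) (hs.visited_mem k)
      obtain ⟨o', h1, h2⟩ := owned k hkb
      exact ⟨hs.mem_order k hkb, o', ((best k hkb).isFavorite hs.mem_objects).1 o' h1,
        (harcV k hk).trans h1, hpoint k hkb o' h2⟩
    by_cases hnc : next c ∈ insert c V
    · have hV : insert c V = {i | i ∈ b} := by
        refine minimal _ ?_ ⟨c, Or.inl rfl⟩ ?_
        · rintro k (rfl | hk)
          · exact hs.top_mem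
          · exact hs.visited_mem k hk
        · rintro k (rfl | hk)
          · exact hnc
          · exact hs.next_visited k hk
      rw [hV] at hlink harcV
      have hreach : ∀ z ∈ b, ∀ w ∈ b, Relation.TransGen (Γ.Link r s arc) z w := by
        intro z hz w hw
        have hW := minimal {w | w ∈ b ∧ Relation.TransGen (Γ.Link r s arc) z w} (fun w hw => hw.1)
          ⟨next z, next_mem z hz, .single (hlink z hz)⟩
          fun w hw => ⟨next_mem w hw.1, hw.2.tail (hlink w hw.1)⟩
        have hw' : w ∈ {i | i ∈ b} := hw
        rw [← hW] at hw'
        exact hw'.2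
      have hK : ∀ k, k ∈ Γ.cycleAgents r s arc c ↔ k ∈ b := by
        refine fun k => ⟨fun hk => ?_, fun hk =>
          ⟨hreach c hs.top_mem k hk, hreach k hk c hs.top_mem⟩⟩
        have hk' := hk.1
        clear hk
        induction hk' with
        | single hk => exact hk.eq (hlink c hs.top_mem) ▸ next_mem c hs.top_mem
        | tail _ hk ih => exact hk.eq (hlink _ ih) ▸ next_mem _ ih
      have hstep := YStep.trade s c tl o arc htl hfav harc
        (hreach c hs.top_mem c hs.top_mem)
      refine ⟨_, .single hstep, hs.inv.step h hall hstep, ?_, fun o' => ?_, fun k hk => ?_,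
        fun k hk => ?_⟩
      · exact hs.filter_order _ fun k => by simp [hK]
      · simp only [Set.mem_sdiff, hs.mem_objects, cycleObjects, hK, Set.mem_ofPred_eq,
          List.mem_append, not_exists, not_and]
        constructor
        · rintro ⟨h1, h2⟩ j (hj | hj)
          · exact h1 j hj
          · exact harcV j hj ▸ h2 j hj
        · exact fun h1 => ⟨fun j hj => h1 j (Or.inl hj), fun j hj => by
            rw [harcV j hj]
            exact h1 j (Or.inr hj)⟩
      · simp only [hK]
        split_ifs with hkb
        · exact harcV k hkb
        · exact hs.assigned_eq k ((List.mem_append.mp hk).resolve_right hkb)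
      · have hkb : k ∉ b := fun hkb => hbr k hkb hk
        have hko : k ∈ s.order := by
          rw [← hs.filter_order (fun k => decide (k ∉ b)) (by simp)] at hk
          exact List.mem_of_mem_filter hk
        refine harcn k hko ?_
        rw [hV]
        exact hkb
    · have hncycle : ¬ Γ.OnCycle r s arc c := by
        intro hcyc
        obtain ⟨k, h1, h2⟩ := Relation.TransGen.head'_iff.mp hcyc
        have hk := h1.eq (hlink c (Or.inl rfl))
        rw [hk] at h2
        rcases Relation.ReflTransGen.cases_head h2 with h3 | ⟨k', ⟨-, o', -, h3, -⟩, -⟩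
        · exact hnc (Or.inl h3)
        · rw [harcn _ (hs.mem_order _ (next_mem c hs.top_mem)) hnc] at h3
          cases h3
      have hstep := YStep.request s c tl o (next c) arc htl hfav (hpoint c hs.top_mem o hoc) harc
        hncycle
      have hnb := next_mem c hs.top_mem
      have hcard : (insert c V)ᶜ.ncard < Vᶜ.ncard :=
        Set.ncard_lt_ncard ⟨fun k hk hkV => hk (Or.inr hkV),
          fun hsub => hsub hs.top_not_mem (Or.inl rfl)⟩ (Set.toFinite _)
      obtain ⟨s', h1, h2⟩ := ih (insert c V) (next c) _ (by omega)
        { inv := hs.inv.step h hall hstep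
          top := ⟨_, rfl⟩
          top_mem := hnb
          top_not_mem := hnc
          visited_mem := by
            rintro k (rfl | hk)
            · exact hs.top_mem
            · exact hs.visited_mem k hk
          next_visited := by
            rintro k (rfl | hk)
            · exact Or.inl rfl
            · exact Or.inr (hs.next_visited k hk)
          mem_order := by
            intro k hk
            by_cases hkn : k = next c
            · exact hkn ▸ List.mem_cons_self
            · exact List.mem_cons_of_mem _ (by simpa [hkn] using hs.mem_order k hk)
          -- Only an agent of `b` is moved, so the others keep their relative order.
          filter_order := by
            intro K hK
            rw [List.filter_cons_of_neg (by simp [hK, hnb]), List.filter_filter,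
              ← hs.filter_order K hK]
            refine List.filter_congr fun k _ => ?_
            by_cases hKk : K k = true
            · have hkn : k ≠ next c := fun hkn => (hK k).mp hKk (hkn ▸ hnb)
              simp [hKk, hkn]
            · simp [hKk]
          mem_objects := hs.mem_objects
          assigned_eq := hs.assigned_eq
          arc_eq := harcV
          arc_eq_none := by
            intro k hk hkV
            refine harcn k ?_ hkV
            rcases List.mem_cons.mp hk with rfl | hk
            · exact hs.mem_order _ hnb
            · exact List.mem_of_mem_filter hk }
      exact ⟨s', .head hstep h1, h2⟩

theorem Schedule.exists_ready [Finite I] (h : Γ.OwnedBy own) (hall : ∀ i, i ∈ r) (hnd : r.Nodup)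
    {l : List I} (hl : Γ.Schedule own μ l) : ∀ rest, r = l ++ rest →
      ∃ s, Relation.ReflTransGen (Γ.YStep r) (Γ.yInit r) s ∧ Γ.Ready own μ r l rest s := by
  induction hl with
  | nil =>
    rintro rest rfl
    exact ⟨_, .refl, pointerInvariant_init hall, rfl, by simp [yInit], by simp, fun _ _ => rfl⟩
  | single i prev not_mem best free ih =>
    intro rest hr
    rw [List.append_assoc, List.singleton_append] at hr
    obtain ⟨s, h1, h2⟩ := ih (i :: rest) hr
    obtain ⟨s', h3, h4⟩ := h2.single h hr hall hnd best free
    exact ⟨s', h1.tail h3, h4⟩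
  | @cycle l a b next prev nodup not_mem best owned next_mem minimal ih =>
    intro rest hr
    rw [List.append_assoc] at hr
    obtain ⟨s, h1, h2⟩ := ih ((a :: b) ++ rest) hr
    rw [hr] at hnd
    have hnd' := (List.nodup_append'.mp (List.nodup_append'.mp hnd).2.1).2.2
    have hbr : ∀ i ∈ a :: b, i ∉ rest := fun i hi hi' => hnd' hi hi'
    have hF : Γ.Forming own μ next r l (a :: b) rest ∅ a s :=
      { inv := h2.inv
        top := ⟨_, h2.order_eq⟩
        top_mem := List.mem_cons_self
        top_not_mem := id
        visited_mem := fun _ hv => absurd hv id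
        next_visited := fun _ hv => absurd hv id
        mem_order := fun i hi => by
          rw [h2.order_eq]
          exact List.mem_append_left _ hi
        filter_order := fun K hK => by
          rw [h2.order_eq, List.filter_append, List.filter_eq_nil_iff.mpr, List.nil_append,
            List.filter_eq_self]
          · exact fun k hk => (hK k).mpr fun hk' => hbr k hk' hk
          · exact fun k hk hKk => (hK k).mp hKk hk
        mem_objects := h2.mem_objects
        assigned_eq := h2.assigned_eq
        arc_eq := fun _ hv => absurd hv id
        arc_eq_none := fun k hk _ => h2.arc_eq_none k (h2.order_eq ▸ hk) }
    obtain ⟨s', h3, h4⟩ := Forming.exists_ready h hall hbr best owned next_mem minimal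
      _ _ _ _ le_rfl hF
    exact ⟨s', h1.trans h3, h4⟩

theorem Schedule.mem_yrmhOutcomes [Finite I] (h : Γ.OwnedBy own) {l : List I}
    (hl : Γ.Schedule own μ l) (hall : ∀ i, i ∈ l) : μ ∈ Γ.yrmhOutcomes := by
  obtain ⟨s, h1, h2⟩ := hl.exists_ready h hall hl.nodup [] (List.append_nil l).symm
  exact ⟨l, hl.nodup, hall, s, h1, h2.order_eq, funext fun i => h2.assigned_eq i (hall i)⟩

end Economy

namespace Economy

variable {I O : Type*} {Γ : Economy I O} {own : O → Option I} {r : List I} {s s' : YState I O}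
  {μ : I → Option O}

/-! ### Outcomes are ranked -/

/-- The agents of `K` get one common new rank after all the others; the tie allows them to hold each
other's private objects. -/
theorem IsRanked.union [Finite I] {ν : I → Option O} {S K : Set I} (h : Γ.IsRanked own μ S)
    (hS : ∀ i ∈ S, ν i = μ i) (hK : ∀ i ∈ K, i ∉ S)
    (best : ∀ i ∈ K, ∀ y ∈ leftOver ν S, Γ.WeaklyPrefers i (ν i) y)
    (closed : ∀ i ∈ K, ∀ o m, ν i = some o → own o = some m → m ∈ S ∨ m ∈ K) :
    Γ.IsRanked own ν (S ∪ K) := by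
  classical
  obtain ⟨t, ht⟩ := h
  obtain ⟨n, hn⟩ : ∃ n, ∀ i, t i < n := by
    obtain ⟨n, hn⟩ := (Set.finite_range t).bddAbove
    exact ⟨n + 1, fun i => Nat.lt_succ_of_le (hn ⟨i, rfl⟩)⟩
  set t' : I → ℕ := fun i => if i ∈ S then t i else n with ht'
  have htS : ∀ i ∈ S, t' i = t i := fun i hi => if_pos hi
  have htK : ∀ i ∈ K, t' i = n := fun i hi => if_neg (hK i hi)
  refine ⟨t', ?_⟩
  rintro i (hi | hi)
  · rw [hS i hi, htS i hi]
    refine ⟨fun y hy => (ht i hi).1 y fun j hj hji o ho => ?_, fun o m ho hm => ?_⟩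
    · rw [← hS j hj]
      exact hy j (Or.inl hj) (by rwa [htS j hj]) o ho
    · obtain ⟨h1, h2⟩ := (ht i hi).2 o m ho hm
      exact ⟨Or.inl h1, by rwa [htS m h1]⟩
  · rw [htK i hi]
    refine ⟨fun y hy => best i hi y fun j hj o ho => ?_, fun o m ho hm => ?_⟩
    · exact hy j (Or.inl hj) (by rw [htS j hj]; exact hn j) o ho
    · rcases closed i hi o m ho hm with h1 | h1
      · exact ⟨Or.inl h1, by rw [htS m h1]; exact (hn m).le⟩
      · exact ⟨Or.inr h1, (htK m h1).le⟩

/-- The properties of the states of a run from which the outcome is seen to be ranked. -/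
structure RunInvariant (Γ : Economy I O) (own : O → Option I) (r : List I) (s : YState I O) :
    Prop where
  inv : Γ.PointerInvariant own r s
  nodup : s.order.Nodup
  mem_objects : ∀ o, o ∈ s.objects ↔ ∀ j ∉ s.order, s.assigned j ≠ some o
  arc_favorite : ∀ k ∈ s.order, ∀ o ∈ s.objects, s.agentArc k = some o →
    Γ.IsFavorite s k (some o)
  injective : ∀ i ∉ s.order, ∀ j ∉ s.order, ∀ o, s.assigned i = some o → s.assigned j = some o →
    i = j
  ranked : Γ.IsRanked own s.assigned {i | i ∉ s.order}

theorem runInvariant_init (hall : ∀ i, i ∈ r) (hnd : r.Nodup) :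
    Γ.RunInvariant own r (Γ.yInit r) where
  inv := pointerInvariant_init hall
  nodup := hnd
  mem_objects := by simp [yInit, hall]
  arc_favorite := fun _ _ _ _ h => nomatch h
  injective := fun i hi => absurd (hall i) hi
  ranked := ⟨fun _ => 0, fun i hi => absurd (hall i) hi⟩

theorem IsFavorite.of_subset {k : I} {o : O} (h : Γ.IsFavorite s k (some o))
    (hs : s'.objects ⊆ s.objects) (ho : o ∈ s'.objects) : Γ.IsFavorite s' k (some o) :=
  ⟨fun _ h => by cases h; exact ho, fun y hy => h.2 y fun o ho => hs (hy o ho)⟩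

/-- The invariant is preserved when the agents of `K` leave with favorites that are not privately
owned by other remaining agents. -/
theorem RunInvariant.leave [Finite I] (hs : Γ.RunInvariant own r s)
    (hinv : Γ.PointerInvariant own r s') {K : Set I}
    (hnd : s'.order.Nodup) (hK : ∀ k ∈ K, k ∈ s.order)
    (hord : ∀ k, k ∈ s'.order ↔ k ∈ s.order ∧ k ∉ K)
    (hobj : ∀ o, o ∈ s'.objects ↔ o ∈ s.objects ∧ ∀ k ∈ K, s'.assigned k ≠ some o)
    (hassK : ∀ k ∈ K, Γ.IsFavorite s k (s'.assigned k))
    (hass : ∀ k ∉ K, s'.assigned k = s.assigned k)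
    (harc : ∀ k ∈ s'.order, s'.agentArc k = s.agentArc k)
    (hinj : ∀ k ∈ K, ∀ k' ∈ K, ∀ o, s'.assigned k = some o → s'.assigned k' = some o → k = k')
    (hclosed : ∀ k ∈ K, ∀ o m, s'.assigned k = some o → own o = some m → m ∈ s.order → m ∈ K) :
    Γ.RunInvariant own r s' := by
  have hord' : ∀ k, k ∉ s'.order ↔ k ∉ s.order ∨ k ∈ K := fun k => by
    rw [hord]
    tauto
  have hout : ∀ k ∉ s.order, s'.assigned k = s.assigned k := fun k hk =>
    hass k fun hkK => hk (hK k hkK)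
  have hnew : ∀ k ∈ K, ∀ o, s'.assigned k = some o → ∀ j ∉ s.order, s'.assigned j ≠ some o := by
    intro k hk o ho j hj
    rw [hout j hj]
    exact (hs.mem_objects o).mp ((hassK k hk).1 o ho) j hj
  refine ⟨hinv, hnd, fun o => ?_, ?_, ?_, ?_⟩
  · rw [hobj, hs.mem_objects]
    constructor
    · rintro ⟨h1, h2⟩ j hj
      rcases (hord' j).mp hj with hj | hj
      · rw [hout j hj]
        exact h1 j hj
      · exact h2 j hj
    · intro h1
      refine ⟨fun j hj => ?_, fun j hj => h1 j ((hord' j).mpr (Or.inr hj))⟩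
      rw [← hout j hj]
      exact h1 j ((hord' j).mpr (Or.inl hj))
  · intro k hk o ho hko
    rw [harc k hk] at hko
    exact (hs.arc_favorite k ((hord k).mp hk).1 o ((hobj o).mp ho).1 hko).of_subset
      (fun o ho => ((hobj o).mp ho).1) ho
  · intro i hi j hj o hio hjo
    rcases (hord' i).mp hi with hi | hi <;> rcases (hord' j).mp hj with hj | hj
    · rw [hout i hi] at hio
      rw [hout j hj] at hjo
      exact hs.injective i hi j hj o hio hjo
    · exact absurd hio (hnew j hj o hjo i hi)
    · exact absurd hjo (hnew i hi o hio j hj)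
    · exact hinj i hi j hj o hio hjo
  · have hset : {k | k ∉ s'.order} = {k | k ∉ s.order} ∪ K := Set.ext hord'
    rw [hset]
    refine hs.ranked.union hout (fun k hk hk' => hk' (hK k hk)) (fun k hk y hy => ?_)
      fun k hk o m ho hm => ?_
    · refine (hassK k hk).2 y fun o ho => (hs.mem_objects o).mpr fun j hj => ?_
      rw [← hout j hj]
      exact hy j hj o ho
    · by_cases hmo : m ∈ s.order
      · exact Or.inr (hclosed k hk o m ho hm hmo)
      · exact Or.inl hmo

/-- A remaining private owner is always pointed to by her object. Hence an object pointing to nobody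
has no such owner, and in a cycle she is the successor of the agent who takes her object. -/
theorem RunInvariant.step [Finite I] (hs : Γ.RunInvariant own r s) (h : Γ.OwnedBy own)
    (hall : ∀ i, i ∈ r) (hstep : Γ.YStep r s s') : Γ.RunInvariant own r s' := by
  classical
  have hinv := hs.inv.step h hall hstep
  cases hstep with
  | obtain i rest x top fav unheld =>
    have hnd := hs.nodup
    rw [top, List.nodup_cons] at hnd
    refine hs.leave hinv (K := {i}) hnd.2 ?_ (fun k => ?_) (fun o => ?_) ?_ (fun k hk => ?_)
      (fun _ _ => rfl) ?_ ?_
    · rintro _ rfl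
      rw [top]
      exact List.mem_cons_self
    · rw [top, List.mem_cons, Set.mem_singleton_iff]
      constructor
      · exact fun hk => ⟨Or.inr hk, ne_of_mem_of_not_mem hk hnd.1⟩
      · exact fun hk => hk.1.resolve_left hk.2
    · simp
    · rintro _ rfl
      simpa using fav
    · exact Function.update_of_ne hk ..
    · rintro _ rfl _ rfl _ _ _
      rfl
    · rintro _ rfl o m ho hm hmo
      have h1 := unheld o (by simpa using ho)
      rw [hs.inv.pointer_owned h hall hm hmo] at h1
      cases h1
  | trade i rest o arc top fav arc_eq cycle =>
    set K := Γ.cycleAgents r s arc i with hK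
    have harc : ∀ k, k ≠ i → arc k = s.agentArc k := fun k hk => by
      rw [arc_eq]
      exact Function.update_of_ne hk ..
    have hassK : ∀ k ∈ K, (if k ∈ K then arc k else s.assigned k) = arc k := fun k hk => if_pos hk
    refine hs.leave hinv (K := K) (hs.nodup.filter _) (fun k hk => mem_order_of_mem_cycleAgents hk)
      (fun k => by simp) (fun o => ?_) (fun k hk => ?_) (fun k hk => if_neg hk) (fun k hk => ?_) ?_
      ?_
    · simp only [Set.mem_sdiff, cycleObjects, Set.mem_ofPred_eq, not_exists, not_and]
      refine and_congr_right fun _ => forall₂_congr fun k hk => ?_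
      rw [hassK k hk]
    · change Γ.IsFavorite s k (if k ∈ K then arc k else s.assigned k)
      rw [hassK k hk]
      obtain ⟨-, -, hko, o', ho', hk', -⟩ := exists_link_of_mem_cycleAgents hk
      by_cases hki : k = i
      · have : arc k = some o := by
          rw [arc_eq, hki]
          exact Function.update_self ..
        rw [this, hki]
        exact fav
      · rw [hk']
        -- This arc may date from an earlier request; its object is still a favorite, since the set
        -- of objects has only shrunk.
        exact hs.arc_favorite k hko o' ho' ((harc k hki).symm.trans hk')
    · refine harc k ?_
      rintro rfl
      have hk' : k ∉ K := by simpa using List.of_mem_filter hk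
      exact hk' ⟨cycle, cycle⟩
    · intro k hk k' hk' o' h1 h2
      exact cycle_arc_injOn hk hk' ((hassK k hk).symm.trans h1) ((hassK k' hk').symm.trans h2)
    · intro k hk o' m h1 h2 h3
      have h1 := (hassK k hk).symm.trans h1
      obtain ⟨k', hk', -, o2, -, h4, h5⟩ := exists_link_of_mem_cycleAgents hk
      cases h1.symm.trans h4
      rw [hs.inv.pointer_owned h hall h2 h3] at h5
      cases h5
      exact hk'
  | request i rest o j arc top fav held arc_eq no_cycle =>
    have hjo := hs.inv.mem_order held
    have hord : ∀ k, k ∈ j :: s.order.filter (fun k => decide (k ≠ j)) ↔ k ∈ s.order := by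
      intro k
      by_cases hkj : k = j
      · simp [hkj, hjo]
      · simp [hkj]
    refine ⟨hinv, List.nodup_cons.mpr ⟨by simp, hs.nodup.filter _⟩, ?_, ?_, ?_, ?_⟩
    · intro o
      simp only [hord]
      exact hs.mem_objects o
    · intro k hk o' ho' hk'
      have hk := (hord k).mp hk
      by_cases hki : k = i
      · subst hki
        have : arc k = some o := by
          rw [arc_eq]
          exact Function.update_self ..
        cases hk'.symm.trans this
        exact fav
      · refine hs.arc_favorite k hk o' ho' ?_
        rw [← hk']
        change _ = arc k
        rw [arc_eq]
        exact (Function.update_of_ne hki ..).symm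
    · intro k hk k' hk'
      rw [hord] at hk hk'
      exact hs.injective k hk k' hk'
    · simp only [hord]
      exact hs.ranked

theorem isRanked_of_mem_yrmhOutcomes [Finite I] (h : Γ.OwnedBy own) (hμ : μ ∈ Γ.yrmhOutcomes) :
    IsAllocation μ ∧ Γ.IsRanked own μ Set.univ := by
  obtain ⟨r, hnd, hall, s, hrun, hord, rfl⟩ := hμ
  have hs : Γ.RunInvariant own r s := by
    clear hord
    induction hrun with
    | refl => exact runInvariant_init hall hnd
    | tail _ hstep ih => exact ih.step h hall hstep
  have hnot : ∀ i, i ∉ s.order := by simp [hord]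
  refine ⟨fun i j o hi hj => hs.injective i (hnot i) j (hnot j) o hi hj, ?_⟩
  have hset : {i | i ∉ s.order} = Set.univ := Set.eq_univ_of_forall hnot
  exact hset ▸ hs.ranked

end Economy

theorem mainTheorem9 {I O : Type*} [Finite I] [Finite O] (Γ : Economy I O) (hΓ : Γ.IsHET)
    (p : LinearOrder (Option O)) (hp : ∀ o : O, p.lt (some o) none) :
    Γ.yrmhOutcomes = Γ.rectifiedCoreStar p ∧ Γ.rectifiedCoreStar p = Γ.exclusionCore := by
  obtain ⟨own, h⟩ := hΓ.exists_ownedBy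
  have hrect : ∀ {μ}, μ ∈ Γ.rectifiedCoreStar p → μ ∈ Γ.yrmhOutcomes := fun hμ =>
    let ⟨_, hl, hall⟩ := Economy.exists_schedule_of_mem_rectifiedCoreStar h hp hμ
    hl.mem_yrmhOutcomes h hall
  have hexcl : ∀ {μ}, μ ∈ Γ.exclusionCore → μ ∈ Γ.yrmhOutcomes := fun hμ =>
    let ⟨_, hl, hall⟩ := Economy.exists_schedule_of_mem_exclusionCore h hμ
    hl.mem_yrmhOutcomes h hall
  have hrect' : ∀ {μ}, μ ∈ Γ.yrmhOutcomes → μ ∈ Γ.rectifiedCoreStar p := fun hμ =>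
    let ⟨h1, h2⟩ := Economy.isRanked_of_mem_yrmhOutcomes h hμ
    h2.mem_rectifiedCoreStar h hp h1
  have hexcl' : ∀ {μ}, μ ∈ Γ.yrmhOutcomes → μ ∈ Γ.exclusionCore := fun hμ =>
    let ⟨h1, h2⟩ := Economy.isRanked_of_mem_yrmhOutcomes h hμ
    h2.mem_exclusionCore h h1
  exact ⟨Set.ext fun _ => ⟨hrect', hrect⟩,
    Set.ext fun _ => ⟨fun hμ => hexcl' (hrect hμ), fun hμ => hrect' (hexcl hμ)⟩⟩
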